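/- Let $r\ge 2$. A hypergraph $\mathcal H=(V,E)$ with finite vertex set $V$ and $E\subseteq\mathcal P(V)$ is $r$-uniform if every edge has exactly $r$ vertices. A walk is an alternating sequence $v_1e_1v_2\cdots v_\ell e_\ell v_{\ell+1}$ of vertices and edges with $v_i,v_{i+1}\in e_i$; it is a path if its vertices are distinct and its edges are distinct, and it is a cycle if $\ell\ge 2$, $v_{\ell+1}=v_1$, the vertices $v_1,\dots,v_\ell$ are distinct and the edges $e_1,\dots,e_\ell$ are distinct. A superforest is a hypergraph without cycles; a supertree is a superforest in which any two vertices are linked by a path. For an $r$-uniform hypergraph $\mathcal H$ with $n$ vertices let $m(\mathcal H,k)$ be the number of sets of $k$ pairwise disjoint edges, with $m(\mathcal H,0)=1$, and let $$\varphi(\mathcal H,x)=\sum_{k\ge 0}(-1)^k\,m(\mathcal H,k)\,x^{n-kr}$$ be its matching polynomial. The adjacency tensor of $\mathcal H$ is the tensor $\mathcal A=(a_{i_1\cdots i_r})_{i_1,\dots,i_r\in V}$ with $a_{i_1\cdots i_r}=\frac1{(r-1)!}$ if $\{i_1,\dots,i_r\}\in E$ and $a_{i_1\cdots i_r}=0$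 otherwise; $\lambda\in\mathbb C$ is an eigenvalue of $\mathcal A$ if there is a nonzero $x\in\mathbb C^V$ with $\sum_{i_2,\dots,i_r\in V}a_{ii_2\cdots i_r}x_{i_2}\cdots x_{i_r}=\lambda x_i^{r-1}$ for all $i\in V$. The spectral radius $\rho(\mathcal H)$ is the maximum modulus of the eigenvalues of $\mathcal A$. For $r$-uniform superforests $\mathcal H',\mathcal H$ with the same number of vertices, write $\mathcal H'\preceq\mathcal H$ if $\varphi(\mathcal H',x)\ge\varphi(\mathcal H,x)$ for every real $x\ge\rho(\mathcal H')$, and write $\mathcal H'\prec\mathcal H$ (equivalently $\mathcal H\succ\mathcal H'$) if $\mathcal H'\preceq\mathcal H$ and $\varphi(\mathcal H',x)-\varphi(\mathcal H,x)$ does not vanish at $x=\rho(\mathcal H')$. The $r$-uniform loose path of length $m\ge 0$ has vertices $0,1,\dots,m(r-1)$ and the $m$ edges $\{i(r-1),i(r-1)+1,\dots,(i+1)(r-1)\}$, $0\le i<m$. For an $r$-uniform hypergraph $\mathcal T$, a vertex $v$ of $\mathcal T$ and integers $p,q\ge 0$, let $\mathcal T(v;p,q)$ be the hypergraph obtained from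 the disjoint union of $\mathcal T$ and two $r$-uniform loose paths of lengths $p$ and $q$ by identifying the end vertex $0$ of each of the two paths with $v$. **Theorem.** Let $\mathcal T$ be an $r$-uniform supertree with at least one edge, let $v$ be a vertex of $\mathcal T$, and let $p\ge q\ge 1$ be integers. Then $$\mathcal T(v;p,q)\succ\mathcal T(v;p+1,q-1).$$ In particular, $\rho(\mathcal T(v;p,q))>\rho(\mathcal T(v;p+1,q-1))$. -/

import Mathlib

open scoped Hypergraph

noncomputable section

/-! ### Tensors and their eigenvalues -/

/-- A real tensor of order `r ≥ 2` with indices in `ι`: the entry with indices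
`(i, i₂, …, i_r)` is `A i ![i₂, …, i_r]`. -/
def RealTensor (ι : Type*) (r : ℕ) : Type _ := ι → (Fin (r - 1) → ι) → ℝ

namespace RealTensor

variable {ι : Type*} {r : ℕ}

/-- The vector `A x`, with `i`-th entry `∑ a_{i i₂ … i_r} x_{i₂} ⋯ x_{i_r}`. It is used for
finite `ι` only, where the sum is an ordinary finite sum. -/
def apply (A : RealTensor ι r) (x : ι → ℂ) (i : ι) : ℂ :=
  ∑ᶠ f : Fin (r - 1) → ι, (A i f : ℂ) * ∏ j, x (f j)

/-- `lam` is an eigenvalue of `A`: there is `x ≠ 0` with `A x = lam x^{[r-1]}`. -/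
def IsEigenvalue (A : RealTensor ι r) (lam : ℂ) : Prop :=
  ∃ x : ι → ℂ, x ≠ 0 ∧ ∀ i, A.apply x i = lam * x i ^ (r - 1)

/-- The spectral radius: the maximum modulus of the eigenvalues. -/
def spectralRadius (A : RealTensor ι r) : ℝ :=
  sSup {t : ℝ | ∃ lam : ℂ, A.IsEigenvalue lam ∧ t = ‖lam‖}

end RealTensor

namespace Hypergraph

variable {α β : Type*}

/-! ### Uniform hypergraphs, walks, supertrees -/

/-- Every edge has exactly `r` vertices. -/
def IsUniform (H : Hypergraph α) (r : ℕ) : Prop := ∀ e ∈ E(H), e.encard = r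

/-- `v 0, e 0, v 1, e 1, …, e (l - 1), v l` is a walk of length `l` (the values of `v` beyond `l`
and of `e` beyond `l - 1` are irrelevant). -/
def IsWalk (H : Hypergraph α) (l : ℕ) (v : ℕ → α) (e : ℕ → Set α) : Prop :=
  v 0 ∈ V(H) ∧ ∀ i < l, e i ∈ E(H) ∧ v i ∈ e i ∧ v (i + 1) ∈ e i

/-- A path: a walk whose vertices are distinct and whose edges are distinct. -/
def IsPath (H : Hypergraph α) (l : ℕ) (v : ℕ → α) (e : ℕ → Set α) : Prop :=
  H.IsWalk l v e ∧ Set.InjOn v (Set.Iic l) ∧ Set.InjOn e (Set.Iio l)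

/-- A cycle: a closed walk `v 0, e 0, …, e (l - 1), v l = v 0`, of length at least two, in which
`v 0, …, v (l - 1)` are distinct and `e 0, …, e (l - 1)` are distinct. -/
def IsCycle (H : Hypergraph α) (l : ℕ) (v : ℕ → α) (e : ℕ → Set α) : Prop :=
  2 ≤ l ∧ H.IsWalk l v e ∧ v l = v 0 ∧ Set.InjOn v (Set.Iio l) ∧ Set.InjOn e (Set.Iio l)

/-- Any two vertices are linked by a path. -/
def IsConnected (H : Hypergraph α) : Prop :=
  ∀ u ∈ V(H), ∀ w ∈ V(H), ∃ l v e, H.IsPath l v e ∧ v 0 = u ∧ v l = w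

/-- An acyclic hypergraph. -/
def IsSuperforest (H : Hypergraph α) : Prop := ∀ l v e, ¬ H.IsCycle l v e

/-- A connected superforest. -/
def IsSupertree (H : Hypergraph α) : Prop := H.IsConnected ∧ H.IsSuperforest

/-! ### Spectral radius and matching polynomial of an `r`-uniform hypergraph -/

open Classical in
/-- The adjacency tensor of an `r`-uniform hypergraph: the `(i, i₂, …, i_r)` entry is
`1 / (r - 1)!` if `{i, i₂, …, i_r}` is an edge, and `0` otherwise. -/
def adjTensor (r : ℕ) (H : Hypergraph α) : RealTensor V(H) r := fun i f =>
  if insert (i : α) (Set.range fun j => (f j : α)) ∈ E(H) then 1 / ((r - 1).factorial : ℝ) else 0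

/-- The spectral radius `ρ(H)` of an `r`-uniform hypergraph. -/
def spectralRadius (r : ℕ) (H : Hypergraph α) : ℝ := (adjTensor r H).spectralRadius

/-- The number `m(H, k)` of `k`-matchings, that is, of sets of `k` pairwise nonadjacent edges. -/
def matchingCount (H : Hypergraph α) (k : ℕ) : ℕ :=
  Set.ncard {M : Set (Set α) | M ⊆ E(H) ∧ M.Pairwise (fun e f => ¬ H.EAdj e f) ∧ M.encard = k}

/-- The matching polynomial `φ(H, x) = ∑_{k ≥ 0} (-1)^k m(H, k) x^{n - k r}` of an `r`-uniform
hypergraph with `n` vertices, `r ≥ 1`. A `k`-matching covers `k r` vertices, so the coefficient is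
`0` unless `k r ≤ n`; hence the terms with `k > n` may be left out and the truncated subtraction
`n - k r` is harmless. -/
def matchingPoly (r : ℕ) (H : Hypergraph α) : Polynomial ℝ :=
  ∑ k ∈ Finset.range (V(H).ncard + 1),
    Polynomial.C ((-1) ^ k * (H.matchingCount k : ℝ)) * Polynomial.X ^ (V(H).ncard - k * r)

/-! ### The order on superforests -/

/-- `H' ⪯ H` for finite `r`-uniform superforests with equally many vertices:
`φ(H', x) ≥ φ(H, x)` for every `x ≥ ρ(H')`. -/
structure MatchLE (r : ℕ) (H' : Hypergraph α) (H : Hypergraph β) : Prop where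
  finite_left : V(H').Finite
  finite_right : V(H).Finite
  uniform_left : H'.IsUniform r
  uniform_right : H.IsUniform r
  superforest_left : H'.IsSuperforest
  superforest_right : H.IsSuperforest
  order_eq : V(H').ncard = V(H).ncard
  eval_le : ∀ x : ℝ, spectralRadius r H' ≤ x →
    (matchingPoly r H).eval x ≤ (matchingPoly r H').eval x

/-- `H' ≺ H`: `H' ⪯ H`, and `φ(H', x) - φ(H, x)` does not vanish at `x = ρ(H')`. -/
def MatchLT (r : ℕ) (H' : Hypergraph α) (H : Hypergraph β) : Prop :=
  MatchLE r H' H ∧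
    (matchingPoly r H' - matchingPoly r H).eval (spectralRadius r H') ≠ 0

/-! ### Attaching paths -/

open Classical in
/-- The coalescence of `G` and `H`: the disjoint union of `G` and `H` with the vertex `w` of `H`
identified with the vertex `u` of `G`. The new vertex is `Sum.inl u`. -/
def coalescence (G : Hypergraph α) (u : α) (H : Hypergraph β) (w : β) : Hypergraph (α ⊕ β) where
  vertexSet := V(G.image Sum.inl) ∪ V(H.image fun b => if b = w then Sum.inl u else Sum.inr b)
  edgeSet := E(G.image Sum.inl) ∪ E(H.image fun b => if b = w then Sum.inl u else Sum.inr b)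
  subset_vertexSet_of_mem_edgeSet' := by
    rintro e (he | he)
    · exact (subset_vertexSet_of_mem_edgeSet he).trans Set.subset_union_left
    · exact (subset_vertexSet_of_mem_edgeSet he).trans Set.subset_union_right

/-- The `r`-uniform loose path with `m` edges (`r ≥ 2`), the `r`-th power of the path with `m`
edges: its vertices are `0, 1, …, m (r - 1)`, and its edges are the `m` blocks
`{i (r - 1), …, (i + 1) (r - 1)}`, `i < m`. Its end vertices are `0` and `m (r - 1)`; for `m = 0` it
is a single vertex. -/
def loosePath (r m : ℕ) : Hypergraph ℕ where
  vertexSet := Set.Iic (m * (r - 1))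
  edgeSet := {e | ∃ i < m, e = Set.Icc (i * (r - 1)) ((i + 1) * (r - 1))}
  subset_vertexSet_of_mem_edgeSet' := by
    rintro e ⟨i, hi, rfl⟩ x hx
    exact hx.2.trans (Nat.mul_le_mul_right _ hi)

/-- `T(v; p, q)`: the `r`-uniform hypergraph `T` with two pendent paths of lengths `p` and `q`
attached at the vertex `v`. -/
def graft (r : ℕ) (T : Hypergraph α) (v : α) (p q : ℕ) : Hypergraph ((α ⊕ ℕ) ⊕ ℕ) :=
  coalescence (coalescence T v (loosePath r p) 0) (Sum.inl v) (loosePath r q) 0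

end Hypergraph

end

/-! Write φ for the matching polynomial and let A = φ(T), B = φ(T − v), P_m = φ of the loose path
with m edges, and Q_m = φ of that path without its end 0. Expanding at vertices gives a gluing
formula (`matchEval_gluing`), hence φ(T(v;p,q)) in terms of A, B and the P, Q (`matchEval_graft`).
The path recurrences then make the difference of the two grafts collapse like a determinant
(`path_pair_identity`): with p = k + d + 1 and q = k + 1, φ(T(v;p+1,q−1)) − φ(T(v;p,q)) =
x^((r−2)(k+1)) · Q_d · (xB − A), and xB − A is the sum of φ(T − e) over the edges e at v. Every
factor other than the power of x belongs to a proper induced subsystem of T(v;p+1,q−1), so it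
suffices that such subsystems have positive φ from the spectral radius on.

This follows once the spectral radius is identified with the largest root of φ
(`spectralRadius_eq_largest_root`). Positivity of φ on a half-line passes to induced subsystems
(`matchEval_pos_of_subset`), and for a connected system it holds for proper ones even at the largest
root l (`matchEval_pos_of_ssubset`). At l the vector y_i = φ(H − i)^(1/r) is a positive eigenvector
(`exists_pos_eigenvector`): acyclicity makes φ factor over the components left after deleting an
edge e, whence the product of the y_j over j ∈ e is φ(H − e), and the eigenvalue equation at i is
the vertex recurrence at i. An eigenvalue with a positive eigenvector dominates all moduli
(`spectralRadius_eq_of_pos_eigenvector`).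

Acyclicity and connectedness are used only as statements about cuts (`SeparatesEdges`,
`LinksVertices`), which survive gluing without any surgery on walks. The inequality of radii follows
by evaluating at the radius of T(v;p+1,q−1): there its own polynomial vanishes, so that of T(v;p,q)
is negative and still has a root further right. -/

noncomputable section

namespace Hypergraph

/-! ### Matching polynomials of set systems -/

section SetSystem

open Classical

variable {α : Type*} {β : Type*} [DecidableEq α] [DecidableEq β]

/-- The matchings of the set system `E` all of whose members lie in `V`. -/
def matchingsOn (E : Set (Finset α)) (V : Finset α) : Finset (Finset (Finset α)) :=
  (V.powerset.filter (· ∈ E)).powerset.filter fun M => (M : Set (Finset α)).PairwiseDisjoint id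

/-- The value at `x` of the matching polynomial of the set system induced by `E` on `V`. -/
def matchEval (E : Set (Finset α)) (V : Finset α) (x : ℝ) : ℝ :=
  ∑ M ∈ matchingsOn E V, (-1) ^ M.card * x ^ (V \ M.biUnion id).card

lemma mem_matchingsOn {E : Set (Finset α)} {V : Finset α} {M : Finset (Finset α)} :
    M ∈ matchingsOn E V ↔
      (∀ e ∈ M, e ⊆ V ∧ e ∈ E) ∧ ∀ e ∈ M, ∀ f ∈ M, e ≠ f → Disjoint e f := by
  simp only [matchingsOn, Finset.mem_filter, Finset.mem_powerset,
    Finset.subset_iff (s₂ := Finset.filter _ _), Set.PairwiseDisjoint, Set.Pairwise, Function.onFun, Finset.mem_coe, id]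

lemma matchEval_empty {E : Set (Finset α)} (hE : ∅ ∉ E) (x : ℝ) : matchEval E ∅ x = 1 := by
  have : matchingsOn E ∅ = {∅} := by
    ext M
    rw [mem_matchingsOn, Finset.mem_singleton]
    constructor
    · rintro ⟨h, -⟩
      refine Finset.eq_empty_of_forall_notMem fun e he => hE ?_
      obtain ⟨h1, h2⟩ := h e he
      rwa [Finset.subset_empty.mp h1] at h2
    · rintro rfl; simp
  simp [matchEval, this]

/-- The edges of `E` that lie in `V` and contain `v`. -/
def starOn (E : Set (Finset α)) (V : Finset α) (v : α) : Finset (Finset α) :=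
  V.powerset.filter fun e => e ∈ E ∧ v ∈ e

lemma mem_starOn {E : Set (Finset α)} {V e : Finset α} {v : α} :
    e ∈ starOn E V v ↔ e ⊆ V ∧ e ∈ E ∧ v ∈ e := by
  simp [starOn]

/-- The recurrence of the matching polynomial at a vertex. -/
lemma matchEval_vertex (E : Set (Finset α)) {V : Finset α} {v : α} (hv : v ∈ V) (x : ℝ) :
    matchEval E V x =
      x * matchEval E (V.erase v) x - ∑ e ∈ starOn E V v, matchEval E (V \ e) x := by
  have h1 : ∑ M ∈ matchingsOn E V with v ∉ M.biUnion id,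
      (-1 : ℝ) ^ M.card * x ^ (V \ M.biUnion id).card = x * matchEval E (V.erase v) x := by
    rw [matchEval, Finset.mul_sum]
    refine Finset.sum_congr ?_ ?_
    · ext M
      simp only [Finset.mem_filter, mem_matchingsOn, Finset.mem_biUnion, id, not_exists, not_and]
      constructor
      · rintro ⟨⟨h1, h2⟩, h3⟩
        exact ⟨fun e he => ⟨Finset.subset_erase.mpr ⟨(h1 e he).1, h3 e he⟩, (h1 e he).2⟩, h2⟩
      · rintro ⟨h1, h2⟩
        exact ⟨⟨fun e he => ⟨(h1 e he).1.trans (Finset.erase_subset _ _), (h1 e he).2⟩, h2⟩,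
          fun e he => (Finset.subset_erase.mp (h1 e he).1).2⟩
    · intro M hM
      rw [mem_matchingsOn] at hM
      have hvM : v ∉ M.biUnion id := by
        simp only [Finset.mem_biUnion, id, not_exists, not_and]
        exact fun e he => (Finset.subset_erase.mp (hM.1 e he).1).2
      have : V \ M.biUnion id = insert v (V.erase v \ M.biUnion id) := by
        ext u
        by_cases hu : u = v
        · subst hu; simp [hv]; simpa using hvM
        · simp [hu]
      rw [this, Finset.card_insert_of_notMem (by simp), pow_succ]
      ring
  have h2 : ∑ M ∈ matchingsOn E V with v ∈ M.biUnion id,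
      (-1 : ℝ) ^ M.card * x ^ (V \ M.biUnion id).card =
        - ∑ e ∈ starOn E V v, matchEval E (V \ e) x := by
    -- A matching covering `v` has exactly one edge at `v`. The indicator `e ∈ M` lets the two sums
    -- be swapped, and inserting or erasing `e` accounts for the sign.
    have key : ∀ e ∈ starOn E V v, -matchEval E (V \ e) x =
        ∑ M ∈ matchingsOn E V with v ∈ M.biUnion id,
          if e ∈ M then (-1 : ℝ) ^ M.card * x ^ (V \ M.biUnion id).card else 0 := by
      intro e he
      obtain ⟨heV, heE, hve⟩ := mem_starOn.mp he
      rw [← Finset.sum_filter, matchEval, ← Finset.sum_neg_distrib]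
      have hnot : ∀ M ∈ matchingsOn E (V \ e), e ∉ M := fun M hM heM =>
        (Finset.mem_sdiff.mp ((mem_matchingsOn.mp hM).1 e heM |>.1 hve)).2 hve
      refine Finset.sum_bij' (fun M _ => insert e M) (fun M _ => M.erase e) ?_ ?_ ?_ ?_ ?_
      · intro M hM
        have hM' := mem_matchingsOn.mp hM
        simp only [Finset.mem_filter, mem_matchingsOn]
        refine ⟨⟨⟨?_, ?_⟩, ?_⟩, Finset.mem_insert_self _ _⟩
        · intro f hf
          rcases Finset.mem_insert.mp hf with rfl | hf
          · exact ⟨heV, heE⟩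
          · exact ⟨(hM'.1 f hf).1.trans Finset.sdiff_subset, (hM'.1 f hf).2⟩
        · have hd : ∀ f ∈ M, Disjoint f e := fun f hf =>
            Finset.disjoint_of_subset_left (hM'.1 f hf).1 Finset.sdiff_disjoint
          intro f hf g hg hfg
          rcases Finset.mem_insert.mp hf with hf | hf <;>
            rcases Finset.mem_insert.mp hg with hg | hg
          · exact absurd (hf.trans hg.symm) hfg
          · exact hf ▸ (hd g hg).symm
          · exact hg ▸ hd f hf
          · exact hM'.2 f hf g hg hfg
        · exact Finset.mem_biUnion.mpr ⟨e, Finset.mem_insert_self _ _, hve⟩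
      · intro M hM
        simp only [Finset.mem_filter, mem_matchingsOn] at hM
        obtain ⟨⟨⟨h1, h2⟩, -⟩, h3⟩ := hM
        refine mem_matchingsOn.mpr ⟨fun f hf => ⟨?_, (h1 f (Finset.mem_of_mem_erase hf)).2⟩,
          fun f hf g hg => h2 f (Finset.mem_of_mem_erase hf) g (Finset.mem_of_mem_erase hg)⟩
        obtain ⟨hne, hf⟩ := Finset.mem_erase.mp hf
        exact Finset.subset_sdiff.mpr ⟨(h1 f hf).1, h2 f hf e h3 hne⟩
      · intro M hM
        exact Finset.erase_insert (hnot M hM)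
      · intro M hM
        exact Finset.insert_erase (Finset.mem_filter.mp hM).2
      · intro M hM
        rw [Finset.card_insert_of_notMem (hnot M hM), Finset.biUnion_insert, id,
          Finset.sdiff_sdiff_left', show V \ (e ∪ M.biUnion id) = (V \ e) ∩ (V \ M.biUnion id) from by
          ext; simp; tauto]
        ring
    rw [← Finset.sum_neg_distrib, Finset.sum_congr rfl key, Finset.sum_comm]
    refine Finset.sum_congr rfl fun M hM => ?_
    simp only [Finset.mem_filter, mem_matchingsOn, Finset.mem_biUnion, id] at hM
    obtain ⟨⟨h1, h2⟩, e, he, hve⟩ := hM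
    rw [Finset.sum_eq_single e, if_pos he]
    · intro f hf hfe
      refine if_neg fun hfM => ?_
      exact Finset.disjoint_left.mp (h2 f hfM e he hfe) (mem_starOn.mp hf).2.2 hve
    · intro h
      exact absurd (mem_starOn.mpr ⟨(h1 e he).1, (h1 e he).2, hve⟩) h
  rw [matchEval, ← Finset.sum_filter_not_add_sum_filter _
    (fun M : Finset (Finset α) => v ∈ M.biUnion id), h1, h2]
  ring

/-- `matchEval E V` depends only on the members of `E` that lie in `V`. -/
lemma matchEval_congr {E F : Set (Finset α)} {V : Finset α} (h : ∀ e ⊆ V, e ∈ E ↔ e ∈ F) (x : ℝ) :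
    matchEval E V x = matchEval F V x := by
  have : matchingsOn E V = matchingsOn F V := by
    ext M
    simp only [mem_matchingsOn]
    refine and_congr_left fun _ => forall₂_congr fun e _ => ?_
    exact and_congr_right fun he => h e he
  rw [matchEval, matchEval, this]

/-- The recurrence of the matching polynomial at an edge. -/
lemma matchEval_edge {E : Set (Finset α)} {V e : Finset α} (he : e ∈ E) (heV : e ⊆ V)
    (hne : e.Nonempty) (x : ℝ) :
    matchEval E V x = matchEval (E \ {e}) V x - matchEval E (V \ e) x := by
  obtain ⟨v, hv⟩ := hne
  -- Expand with and without `e` at a vertex `v` of `e`: every smaller system in the expansions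
  -- misses `v`, hence does not see `e`.
  have hcongr : ∀ W : Finset α, v ∉ W → matchEval (E \ {e}) W x = matchEval E W x := by
    intro W hW
    refine matchEval_congr (fun f hf => ?_) x
    simp only [Set.mem_sdiff, Set.mem_singleton_iff, and_iff_left_iff_imp]
    rintro - rfl
    exact hW (hf hv)
  have hstar : starOn E V v = insert e (starOn (E \ {e}) V v) := by
    ext f
    simp only [Finset.mem_insert, mem_starOn, Set.mem_sdiff, Set.mem_singleton_iff]
    by_cases hf : f = e
    · subst hf; simp [heV, he, hv]
    · simp [hf]
  rw [matchEval_vertex E (heV hv), matchEval_vertex (E \ {e}) (heV hv), hcongr _ (by simp), hstar,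
    Finset.sum_insert (by simp [mem_starOn])]
  have : ∑ f ∈ starOn (E \ {e}) V v, matchEval (E \ {e}) (V \ f) x =
      ∑ f ∈ starOn (E \ {e}) V v, matchEval E (V \ f) x :=
    Finset.sum_congr rfl fun f hf => hcongr _ (by simp [(mem_starOn.mp hf).2.2])
  rw [this]
  ring

/-- The matching polynomial is multiplicative over unions of components. -/
lemma matchEval_union {E : Set (Finset α)} (hE : ∅ ∉ E) (A B : Finset α) (hAB : Disjoint A B)
    (h : ∀ e ∈ E, e ⊆ A ∪ B → e ⊆ A ∨ e ⊆ B) (x : ℝ) :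
    matchEval E (A ∪ B) x = matchEval E A x * matchEval E B x := by
  induction A using Finset.strongInduction with
  | H A ih =>
    rcases A.eq_empty_or_nonempty with rfl | ⟨v, hv⟩
    · rw [matchEval_empty hE, Finset.empty_union, one_mul]
    have hvB : v ∉ B := Finset.disjoint_left.mp hAB hv
    have hsub : ∀ C ⊂ A, matchEval E (C ∪ B) x = matchEval E C x * matchEval E B x := by
      intro C hC
      refine ih C hC (Finset.disjoint_of_subset_left hC.1 hAB) fun e he heC => ?_
      rcases h e he (heC.trans (Finset.union_subset_union_left hC.1)) with h1 | h1
      · left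
        intro u hu
        rcases Finset.mem_union.mp (heC hu) with h2 | h2
        · exact h2
        · exact absurd h2 (Finset.disjoint_left.mp hAB (h1 hu))
      · exact Or.inr h1
    have hstar : starOn E (A ∪ B) v = starOn E A v := by
      ext e
      simp only [mem_starOn]
      constructor
      · rintro ⟨h1, h2, h3⟩
        exact ⟨(h e h2 h1).resolve_right fun h4 => hvB (h4 h3), h2, h3⟩
      · rintro ⟨h1, h2, h3⟩
        exact ⟨h1.trans Finset.subset_union_left, h2, h3⟩
    rw [matchEval_vertex E (Finset.mem_union_left B hv), matchEval_vertex E hv, hstar,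
      show (A ∪ B).erase v = A.erase v ∪ B by
        rw [Finset.erase_union_distrib, Finset.erase_eq_of_notMem hvB], hsub _ (Finset.erase_ssubset hv),
      sub_mul, Finset.sum_mul, mul_assoc]
    congr 1
    refine Finset.sum_congr rfl fun e he => ?_
    obtain ⟨h1, -, h3⟩ := mem_starOn.mp he
    rw [Finset.union_sdiff_distrib, Finset.sdiff_eq_self_of_disjoint
      (Finset.disjoint_of_subset_right h1 hAB.symm), hsub]
    exact Finset.sdiff_ssubset h1 ⟨v, h3⟩

/-- A set of vertices without edges contributes a power of `x`. -/
lemma matchEval_of_no_edges {E : Set (Finset α)} {V : Finset α} (h : ∀ e ∈ E, ¬ e ⊆ V) (x : ℝ) :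
    matchEval E V x = x ^ V.card := by
  have : matchingsOn E V = {∅} := by
    ext M
    rw [mem_matchingsOn, Finset.mem_singleton]
    constructor
    · rintro ⟨h1, -⟩
      exact Finset.eq_empty_of_forall_notMem fun e he => h e (h1 e he).2 (h1 e he).1
    · rintro rfl; simp
  simp [matchEval, this]

/-- The matching polynomial is invariant under injective relabelling. -/
lemma matchEval_map {E : Set (Finset α)} {F : Set (Finset β)} (g : α ↪ β) (hE : ∅ ∉ E)
    (V : Finset α) (h : ∀ e ⊆ V, e.map g ∈ F ↔ e ∈ E) (x : ℝ) :
    matchEval F (V.map g) x = matchEval E V x := by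
  induction V using Finset.strongInduction with
  | H V ih =>
    rcases V.eq_empty_or_nonempty with rfl | ⟨v, hv⟩
    · rw [matchEval_empty hE, Finset.map_empty, matchEval_empty]
      rwa [← Finset.map_empty g, h ∅ subset_rfl]
    · have hsub : ∀ C ⊂ V, matchEval F (C.map g) x = matchEval E C x := fun C hC =>
        ih C hC fun e he => h e (he.trans hC.1)
      have hstar : starOn F (V.map g) (g v) =
          (starOn E V v).map (Finset.mapEmbedding g).toEmbedding := by
        ext e
        simp only [mem_starOn, Finset.mem_map]
        constructor
        · rintro ⟨h1, h2, h3⟩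
          obtain ⟨e', he', rfl⟩ := Finset.subset_map_iff.mp h1
          exact ⟨e', ⟨he', (h e' he').mp h2, by simpa using h3⟩, rfl⟩
        · rintro ⟨e', ⟨h1, h2, h3⟩, rfl⟩
          exact ⟨by simpa using h1, (h e' h1).mpr h2, by simpa using h3⟩
      rw [matchEval_vertex F (Finset.mem_map_of_mem g hv), matchEval_vertex E hv, hstar,
        Finset.sum_map, ← Finset.map_erase, hsub _ (Finset.erase_ssubset hv)]
      congr 1
      refine Finset.sum_congr rfl fun e he => ?_
      obtain ⟨h1, -, h3⟩ := mem_starOn.mp he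
      rw [← hsub _ (Finset.sdiff_ssubset h1 ⟨v, h3⟩)]
      congr 1
      rw [show (Finset.mapEmbedding g).toEmbedding e = e.map g from rfl]
      ext u
      simp only [Finset.mem_sdiff, Finset.mem_map]
      constructor
      · rintro ⟨⟨a, ha, rfl⟩, h4⟩
        exact ⟨a, ⟨ha, fun h5 => h4 ⟨a, h5, rfl⟩⟩, rfl⟩
      · rintro ⟨a, ⟨ha, h4⟩, rfl⟩
        exact ⟨⟨a, ha, rfl⟩, fun ⟨b, hb, hab⟩ => h4 (g.injective hab ▸ hb)⟩

end SetSystem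

/-! ### The largest root of the matching polynomial -/

section LargestRoot

open Classical

variable {α : Type*} [DecidableEq α] {E : Set (Finset α)}

lemma continuous_matchEval (E : Set (Finset α)) (V : Finset α) : Continuous (matchEval E V) := by
  unfold matchEval
  fun_prop

/-- For large `x` the matching polynomial is positive and increasing in the vertex set. -/
lemma matchEval_pos_of_large (hE : ∅ ∉ E) (U : Finset α) {x : ℝ} (hx : 1 + 2 ^ U.card ≤ x)
    (V : Finset α) (hV : V ⊆ U) :
    ∀ W ⊆ V, 0 < matchEval E W x ∧ matchEval E W x ≤ matchEval E V x := by
  induction V using Finset.strongInduction with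
  | H V ih =>
    have key : ∀ v ∈ V, 0 < matchEval E (V.erase v) x ∧
        matchEval E (V.erase v) x ≤ matchEval E V x := by
      intro v hv
      have ihv := ih (V.erase v) (Finset.erase_ssubset hv) ((Finset.erase_subset _ _).trans hV)
      have hpos := (ihv _ subset_rfl).1
      refine ⟨hpos, ?_⟩
      -- At most `2 ^ U.card` edges pass through `v`, and `U` stays fixed in the induction, so one
      -- threshold for `x` serves all subsets.
      have hsum : ∑ e ∈ starOn E V v, matchEval E (V \ e) x ≤
          (2 ^ U.card : ℝ) * matchEval E (V.erase v) x := by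
        refine (Finset.sum_le_card_nsmul _ _ (matchEval E (V.erase v) x) fun e he => ?_).trans ?_
        · refine (ihv _ ?_).2
          rw [Finset.subset_erase]
          exact ⟨Finset.sdiff_subset, by simp [(mem_starOn.mp he).2.2]⟩
        · rw [nsmul_eq_mul]
          refine mul_le_mul_of_nonneg_right ?_ hpos.le
          have : (starOn E V v).card ≤ 2 ^ U.card := by
            rw [← Finset.card_powerset]
            exact Finset.card_le_card ((Finset.filter_subset _ _).trans (Finset.powerset_mono.mpr hV))
          exact_mod_cast this
      rw [matchEval_vertex E hv]
      nlinarith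
    intro W hW
    rcases hW.eq_or_ssubset with rfl | hlt
    · refine ⟨?_, le_rfl⟩
      rcases W.eq_empty_or_nonempty with rfl | ⟨v, hv⟩
      · rw [matchEval_empty hE]; exact one_pos
      · exact (key v hv).1.trans_le (key v hv).2
    · obtain ⟨v, hv, hvW⟩ := Finset.exists_of_ssubset hlt
      obtain ⟨h1, h2⟩ := ih (V.erase v) (Finset.erase_ssubset hv)
        ((Finset.erase_subset _ _).trans hV) W (Finset.subset_erase.mpr ⟨hW, hvW⟩)
      exact ⟨h1, h2.trans (key v hv).2⟩

lemma matchEval_nonneg_of_pos_above {V : Finset α} {l : ℝ} (h : ∀ y > l, 0 < matchEval E V y) :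
    0 ≤ matchEval E V l := by
  have ht : Filter.Tendsto (matchEval E V) (nhdsWithin l (Set.Ioi l)) (nhds (matchEval E V l)) :=
    (continuous_matchEval E V).continuousWithinAt
  exact ge_of_tendsto ht (Filter.mem_of_superset self_mem_nhdsWithin fun y hy => (h y hy).le)

/-- Above a point where the matching polynomial is not positive there is a largest root. -/
lemma exists_largest_root (hE : ∅ ∉ E) {V : Finset α} {y : ℝ} (hy : matchEval E V y ≤ 0) :
    ∃ z, y ≤ z ∧ matchEval E V z = 0 ∧ ∀ t > z, 0 < matchEval E V t := by
  set S : Set ℝ := {t | matchEval E V t ≤ 0} with hS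
  have hbdd : BddAbove S := by
    refine ⟨1 + 2 ^ V.card, fun t ht => ?_⟩
    by_contra! hlt
    exact absurd ht (not_le.mpr (matchEval_pos_of_large hE V hlt.le V subset_rfl V subset_rfl).1)
  have hcl : IsClosed S := isClosed_le (continuous_matchEval E V) continuous_const
  have hmem : sSup S ∈ S := hcl.csSup_mem ⟨y, hy⟩ hbdd
  have hpos : ∀ t > sSup S, 0 < matchEval E V t := fun t ht =>
    not_le.mp fun h => absurd (le_csSup hbdd h) (not_le.mpr ht)
  exact ⟨sSup S, le_csSup hbdd hy, le_antisymm hmem (matchEval_nonneg_of_pos_above hpos), hpos⟩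

/-- Positivity of the matching polynomial on a half-line is inherited by induced subsystems. -/
lemma matchEval_pos_of_subset (hE : ∅ ∉ E) {V W : Finset α} (hW : W ⊆ V) {l : ℝ}
    (h : ∀ y ≥ l, 0 < matchEval E V y) : ∀ y ≥ l, 0 < matchEval E W y := by
  induction V using Finset.strongInduction generalizing W l with
  | H V ih =>
    rcases hW.eq_or_ssubset with rfl | hlt
    · exact h
    obtain ⟨v, hv, hvW⟩ := Finset.exists_of_ssubset hlt
    refine ih (V.erase v) (Finset.erase_ssubset hv) (Finset.subset_erase.mpr ⟨hW, hvW⟩) ?_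
    -- At the largest root `z` of the polynomial of `V.erase v`, induction makes all terms for `V \
    -- e` nonnegative. The recurrence at `v` then makes the polynomial of `V` nonpositive at `z ≥
    -- l`.
    intro y hy
    by_contra! hneg
    obtain ⟨z, hyz, hz, hpos⟩ := exists_largest_root hE hneg
    have hstar : ∀ e ∈ starOn E V v, 0 ≤ matchEval E (V \ e) z := by
      intro e he
      refine matchEval_nonneg_of_pos_above fun t ht => ?_
      refine ih (V.erase v) (Finset.erase_ssubset hv) (W := V \ e) ?_ (l := t)
        (fun s hs => hpos s (lt_of_lt_of_le ht hs)) t le_rfl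
      rw [Finset.subset_erase]
      exact ⟨Finset.sdiff_subset, by simp [(mem_starOn.mp he).2.2]⟩
    have := h z (hy.trans hyz)
    rw [matchEval_vertex E hv, hz] at this
    linarith [Finset.sum_nonneg hstar]

lemma matchEval_pos_above_of_subset (hE : ∅ ∉ E) {V W : Finset α} (hW : W ⊆ V) {l : ℝ}
    (h : ∀ y > l, 0 < matchEval E V y) : ∀ y > l, 0 < matchEval E W y := fun y hy =>
  matchEval_pos_of_subset hE hW (fun t ht => h t (lt_of_lt_of_le hy ht)) y le_rfl

/-- For a connected system, proper induced subsystems have a positive matching polynomial at the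
largest root. -/
lemma matchEval_pos_of_ssubset (hE : ∅ ∉ E) {V W : Finset α} (hW : W ⊂ V) {l : ℝ}
    (hconn : ∀ W ⊂ V, W.Nonempty → ∃ e ∈ E, e ⊆ V ∧ ¬ e ⊆ W ∧ ¬ Disjoint e W)
    (h : ∀ y > l, 0 < matchEval E V y) : 0 < matchEval E W l := by
  have hnonneg : ∀ U ⊆ V, 0 ≤ matchEval E U l := fun U hU =>
    matchEval_nonneg_of_pos_above (matchEval_pos_above_of_subset hE hU h)
  induction W using Finset.strongInduction with
  | H W ih =>
    rcases W.eq_empty_or_nonempty with rfl | hne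
    · rw [matchEval_empty hE]; exact one_pos
    refine lt_of_le_of_ne (hnonneg W hW.1) fun h0 => ?_
    -- A zero at `l` spreads upwards: a larger `U` that is positive at `l` would be positive from
    -- `l` on, and so would `W`.
    have hzero : ∀ U ⊆ V, W ⊆ U → matchEval E U l = 0 := by
      intro U hU hWU
      refine le_antisymm (not_lt.mp fun hlt => ?_) (hnonneg U hU)
      have : ∀ y ≥ l, 0 < matchEval E U y := fun y hy => by
        rcases eq_or_lt_of_le hy with rfl | hy
        · exact hlt
        · exact matchEval_pos_above_of_subset hE hU h y hy
      exact absurd h0 (matchEval_pos_of_subset hE hWU this l le_rfl).ne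
    obtain ⟨e, he, heV, heW, hdis⟩ := hconn W hW hne
    obtain ⟨u, hue, huW⟩ := Finset.not_subset.mp heW
    have hUV : W ∪ e ⊆ V := Finset.union_subset hW.1 heV
    have huU : u ∈ W ∪ e := Finset.mem_union_right _ hue
    have hrec := matchEval_vertex E huU l
    rw [hzero _ hUV Finset.subset_union_left, hzero ((W ∪ e).erase u)
      ((Finset.erase_subset _ _).trans hUV)
      (Finset.subset_erase.mpr ⟨Finset.subset_union_left, huW⟩)] at hrec
    -- The recurrence at `u` forces this sum to vanish, but its term for `f = e` belongs to `W \ e`,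
    -- smaller than `W` because `e` meets `W`.
    have hlt : 0 < ∑ f ∈ starOn E (W ∪ e) u, matchEval E ((W ∪ e) \ f) l := by
      refine Finset.sum_pos' (fun f _ => hnonneg _ (Finset.sdiff_subset.trans hUV))
        ⟨e, mem_starOn.mpr ⟨Finset.subset_union_right, he, hue⟩, ?_⟩
      have hss : W \ e ⊂ W := by
        refine Finset.ssubset_iff_subset_ne.mpr ⟨Finset.sdiff_subset, fun heq => hdis ?_⟩
        exact (Finset.sdiff_eq_self_iff_disjoint.mp heq).symm
      rw [Finset.union_sdiff_right]
      exact ih _ hss (hss.trans hW)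
    linarith

/-- A uniform system with an edge has a largest root, which is at least `1`. -/
lemma exists_largest_root_of_uniform {r : ℕ} (hr : 0 < r) (hunif : ∀ e ∈ E, e.card = r)
    {V e : Finset α} (he : e ∈ E) (heV : e ⊆ V) :
    ∃ l, 1 ≤ l ∧ matchEval E V l = 0 ∧ ∀ y > l, 0 < matchEval E V y := by
  have hE : ∅ ∉ E := fun h => by simpa [hr.ne] using hunif _ h
  have hne : e.Nonempty := Finset.card_pos.mp (hunif e he ▸ hr)
  -- A single edge has polynomial x^r − 1. Its root 1 prevents the polynomial of `V` from being
  -- positive on all of [1, ∞).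
  have h1 : matchEval E e 1 = 0 := by
    rw [matchEval_edge he subset_rfl hne, matchEval_of_no_edges, Finset.sdiff_self,
      matchEval_empty hE, one_pow, sub_self]
    rintro f ⟨hf, hfe⟩ hsub
    exact hfe (Finset.eq_of_subset_of_card_le hsub (by rw [hunif e he, hunif f hf]))
  have : ∃ y ≥ (1 : ℝ), matchEval E V y ≤ 0 := by
    by_contra! hcon
    exact absurd h1 (matchEval_pos_of_subset hE heV hcon 1 le_rfl).ne'
  obtain ⟨y, hy, hy0⟩ := this
  obtain ⟨z, hyz, hz, hpos⟩ := exists_largest_root hE hy0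
  exact ⟨z, hy.trans hyz, hz, hpos⟩

end LargestRoot

/-! ### A positive eigenvector -/

section PositiveVector

open Classical

variable {α : Type*}

/-- If the vertices `i` and `j` of the edge `e` are distinct, then some set contains `i`, misses `j`,
and is not crossed by any edge other than `e`. -/
def SeparatesEdges (E : Set (Set α)) : Prop :=
  ∀ e ∈ E, ∀ i ∈ e, ∀ j ∈ e, i ≠ j →
    ∃ C : Set α, i ∈ C ∧ j ∉ C ∧ ∀ f ∈ E, f ≠ e → f ⊆ C ∨ Disjoint f C

/-- The edges of a hypergraph, as finsets. -/
def edgeSystem (H : Hypergraph α) : Set (Finset α) := {e | (e : Set α) ∈ E(H)}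

lemma mem_edgeSystem {H : Hypergraph α} {e : Finset α} : e ∈ edgeSystem H ↔ (e : Set α) ∈ E(H) :=
  Iff.rfl

variable [DecidableEq α]

lemma matchEval_filter {E : Set (Finset α)} (hE : ∅ ∉ E) (C : Set α)
    (hC : ∀ f ∈ E, (f : Set α) ⊆ C ∨ Disjoint (f : Set α) C) (V : Finset α) (x : ℝ) :
    matchEval E V x = matchEval E (V.filter (· ∈ C)) x * matchEval E (V.filter (· ∉ C)) x := by
  rw [← matchEval_union hE _ _ (Finset.disjoint_filter_filter_not _ _ _),
    Finset.filter_union_filter_not_eq]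
  intro f hf hsub
  rw [Finset.filter_union_filter_not_eq] at hsub
  rcases hC f hf with h | h
  · exact Or.inl fun u hu => Finset.mem_filter.mpr ⟨hsub hu, h hu⟩
  · exact Or.inr fun u hu => Finset.mem_filter.mpr ⟨hsub hu, Set.disjoint_left.mp h hu⟩

/-- When no two vertices of `e` are linked, deleting them one by one multiplies the matching
polynomial by independent factors. -/
lemma matchEval_sdiff_mul_pow {E : Set (Finset α)} (hE : ∅ ∉ E) {V e : Finset α}
    (hsep : ∀ i ∈ e, ∀ j ∈ e, i ≠ j →
      ∃ C : Set α, i ∈ C ∧ j ∉ C ∧ ∀ f ∈ E, (f : Set α) ⊆ C ∨ Disjoint (f : Set α) C) (x : ℝ)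
    (S : Finset α) (hS : S ⊆ e) :
    matchEval E (V \ S) x * matchEval E V x ^ S.card =
      matchEval E V x * ∏ i ∈ S, matchEval E (V.erase i) x := by
  induction S using Finset.induction_on with
  | empty => simp
  | insert i S hi ih =>
    have hie : i ∈ e := hS (Finset.mem_insert_self _ _)
    have hSe : S ⊆ e := (Finset.subset_insert _ _).trans hS
    -- Intersect the sets separating `i` from each `j ∈ S`; an edge not inside all of them is
    -- disjoint from one of them.
    have : ∃ C : Set α, i ∈ C ∧ (∀ j ∈ S, j ∉ C) ∧
        ∀ f ∈ E, (f : Set α) ⊆ C ∨ Disjoint (f : Set α) C := by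
      choose! C hC1 hC2 hC3 using hsep i hie
      have hne : ∀ j ∈ S, i ≠ j := fun j hj h => hi (h ▸ hj)
      refine ⟨⋂ j ∈ S, C j, ?_, ?_, ?_⟩
      · simp only [Set.mem_iInter]
        exact fun j hj => hC1 j (hSe hj) (hne j hj)
      · intro j hj hmem
        simp only [Set.mem_iInter] at hmem
        exact hC2 j (hSe hj) (hne j hj) (hmem j hj)
      · intro f hf
        by_cases hall : ∀ j ∈ S, (f : Set α) ⊆ C j
        · exact Or.inl (Set.subset_iInter₂ hall)
        · push Not at hall
          obtain ⟨j, hj, hfj⟩ := hall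
          exact Or.inr (Set.disjoint_of_subset_right (Set.iInter₂_subset j hj)
            ((hC3 j (hSe hj) (hne j hj) f hf).resolve_left hfj))
    obtain ⟨C, hiC, hSC, hC⟩ := this
    -- Deleting `i` changes only the factor inside `C`, deleting `S` only the factor outside.
    have hstep : matchEval E (V \ S) x * matchEval E (V.erase i) x =
        matchEval E (V \ insert i S) x * matchEval E V x := by
      have hB : ∀ U : Finset α, (U.erase i).filter (· ∉ C) = U.filter (· ∉ C) := by
        intro U; ext u; simp only [Finset.mem_filter, Finset.mem_erase]
        exact ⟨fun h => ⟨h.1.2, h.2⟩, fun h => ⟨⟨fun hu => h.2 (hu ▸ hiC), h.1⟩, h.2⟩⟩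
      have hA : ∀ U : Finset α, (U \ S).filter (· ∈ C) = U.filter (· ∈ C) := by
        intro U; ext u; simp only [Finset.mem_filter, Finset.mem_sdiff]
        exact ⟨fun h => ⟨h.1.1, h.2⟩, fun h => ⟨⟨h.1, fun hu => hSC u hu h.2⟩, h.2⟩⟩
      have hins : V \ insert i S = (V.erase i) \ S := by
        ext u; simp only [Finset.mem_sdiff, Finset.mem_insert, Finset.mem_erase]; tauto
      have hins' : V \ insert i S = (V \ S).erase i := by
        ext u; simp only [Finset.mem_sdiff, Finset.mem_insert, Finset.mem_erase]; tauto
      rw [matchEval_filter hE C hC (V \ S), matchEval_filter hE C hC (V.erase i),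
        matchEval_filter hE C hC (V \ insert i S), matchEval_filter hE C hC V, hA V, hB V]
      conv_rhs => rw [hins, hA, ← hins, hins', hB]
      ring
    rw [Finset.card_insert_of_notMem hi, Finset.prod_insert hi]
    calc _ = (matchEval E (V \ insert i S) x * matchEval E V x) * matchEval E V x ^ S.card := by ring
      _ = (matchEval E (V \ S) x * matchEval E V x ^ S.card) * matchEval E (V.erase i) x := by
        rw [← hstep]; ring
      _ = _ := by rw [ih hSe]; ring

/-- At a root of the matching polynomial that is larger than all roots of proper induced subsystems,
the `r`-th roots of the matching polynomials of the vertex-deleted subsystems form a positive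
eigenvector. -/
lemma exists_pos_eigenvector {E : Set (Finset α)} {r : ℕ} (hr : 0 < r)
    (hunif : ∀ e ∈ E, e.card = r) {V : Finset α} {l : ℝ} (hroot : matchEval E V l = 0)
    (hpos : ∀ W ⊂ V, 0 < matchEval E W l)
    (hsep : ∀ e ∈ E, ∀ i ∈ e, ∀ j ∈ e, i ≠ j →
      ∃ C : Set α, i ∈ C ∧ j ∉ C ∧ ∀ f ∈ E, f ≠ e → (f : Set α) ⊆ C ∨ Disjoint (f : Set α) C) :
    ∃ y : α → ℝ, (∀ i ∈ V, 0 < y i) ∧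
      ∀ i ∈ V, ∑ e ∈ starOn E V i, ∏ j ∈ e.erase i, y j = l * y i ^ (r - 1) := by
  have hE : ∅ ∉ E := fun h => by simpa [hr.ne] using hunif _ h
  set y : α → ℝ := fun i => matchEval E (V.erase i) l ^ ((r : ℝ)⁻¹) with hy
  have hypos : ∀ i ∈ V, 0 < y i := fun i hi =>
    Real.rpow_pos_of_pos (hpos _ (Finset.erase_ssubset hi)) _
  have hypow : ∀ i ∈ V, y i ^ r = matchEval E (V.erase i) l := fun i hi =>
    Real.rpow_inv_natCast_pow (hpos _ (Finset.erase_ssubset hi)).le hr.ne'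
  refine ⟨y, hypos, fun i hi => ?_⟩
  have hprod : ∀ e ∈ starOn E V i, ∏ j ∈ e, y j = matchEval E (V \ e) l := by
    intro e he
    obtain ⟨heV, heE, hie⟩ := mem_starOn.mp he
    have ha : 0 < matchEval E (V \ e) l := hpos _ (Finset.sdiff_ssubset heV ⟨i, hie⟩)
    have hdel : ∀ W : Finset α, ¬ e ⊆ W → matchEval (E \ {e}) W l = matchEval E W l := by
      intro W hW
      refine matchEval_congr (fun f hf => ?_) l
      simp only [Set.mem_sdiff, Set.mem_singleton_iff, and_iff_left_iff_imp]
      rintro - rfl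
      exact hW hf
    -- At the root, deleting the edge `e` alone or all its vertices gives the same value a. The
    -- factorisation without `e` reads a · a^r = a · ∏ y_j^r, so a = ∏ y_j.
    have h1 := matchEval_edge heE heV ⟨i, hie⟩ l
    have h2 := matchEval_sdiff_mul_pow (E := E \ {e}) (fun h => hE h.1) (V := V)
      (fun i hi j hj hij => by
        obtain ⟨C, hC1, hC2, hC3⟩ := hsep e heE i hi j hj hij
        exact ⟨C, hC1, hC2, fun f hf => hC3 f hf.1 hf.2⟩) l e subset_rfl
    have h3 : matchEval (E \ {e}) V l = matchEval E (V \ e) l := by linarith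
    rw [h3, hdel (V \ e) fun h => (Finset.mem_sdiff.mp (h hie)).2 hie,
      Finset.prod_congr rfl fun j hj => (hdel (V.erase j) fun h => by simpa using h hj).trans
        (hypow j (heV hj)).symm] at h2
    have h4 := mul_left_cancel₀ ha.ne' h2
    rw [hunif e heE, Finset.prod_pow] at h4
    exact (pow_left_inj₀ (Finset.prod_nonneg fun j hj => (hypos j (heV hj)).le) ha.le
      hr.ne').mp h4.symm
  have h5 := matchEval_vertex E hi l
  rw [hroot, ← hypow i hi] at h5
  have h6 : (∑ e ∈ starOn E V i, ∏ j ∈ e.erase i, y j) * y i = l * y i ^ (r - 1) * y i := by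
    rw [Finset.sum_mul, mul_assoc, ← pow_succ, Nat.sub_add_cancel hr,
      Finset.sum_congr rfl fun e he =>
        (Finset.prod_erase_mul e y (mem_starOn.mp he).2.2).trans (hprod e he)]
    linarith
  exact mul_right_cancel₀ (hypos i hi).ne' h6

end PositiveVector

/-! ### The spectral radius -/

section Spectral

open Classical

variable {α : Type*} [DecidableEq α]

/-- Such tuples are the bijections from `Fin k` onto `s`. The resulting `k!` cancels the
normalisation of the adjacency tensor. -/
lemma sum_prod_image_eq {ι R : Type*} [Fintype ι] [DecidableEq ι] [CommSemiring R] {k : ℕ} (s : Finset ι)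
    (hs : s.card = k) (x : ι → R) :
    ∑ f : Fin k → ι with Finset.univ.image f = s, ∏ j, x (f j) =
      (k.factorial : R) * ∏ j ∈ s, x j := by
  have hinj : ∀ f : Fin k → ι, Finset.univ.image f = s → Function.Injective f := by
    intro f hf
    have : Set.InjOn f (Finset.univ : Finset (Fin k)) :=
      Finset.card_image_iff.mp (by rw [hf, hs, Finset.card_univ, Fintype.card_fin])
    simpa using this
  have hprod : ∀ f ∈ Finset.univ.filter fun f : Fin k → ι => Finset.univ.image f = s,
      ∏ j, x (f j) = ∏ j ∈ s, x j := by
    intro f hf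
    have hf' := (Finset.mem_filter.mp hf).2
    rw [← hf', Finset.prod_image fun a _ b _ h => hinj f hf' h]
  rw [Finset.sum_congr rfl hprod, Finset.sum_const, nsmul_eq_mul]
  congr 2
  have hcard : Fintype.card (Fin k ≃ s) = k.factorial := by
    rw [Fintype.card_equiv (Fintype.equivOfCardEq (by simp [hs])), Fintype.card_fin]
  rw [← hcard, ← Finset.card_univ]
  symm
  refine Finset.card_bij (fun e _ j => (e j : ι)) ?_ ?_ ?_
  · intro e _
    simp only [Finset.mem_filter, Finset.mem_univ, true_and]
    ext u
    simp only [Finset.mem_image, Finset.mem_univ, true_and]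
    exact ⟨fun ⟨j, hj⟩ => hj ▸ (e j).2, fun hu => ⟨e.symm ⟨u, hu⟩, by simp⟩⟩
  · intro e _ e' _ h
    ext j
    exact congrFun h j
  · intro f hf
    have hf' := (Finset.mem_filter.mp hf).2
    have hmem : ∀ j, f j ∈ s := fun j => hf' ▸ Finset.mem_image_of_mem f (Finset.mem_univ j)
    refine ⟨Equiv.ofBijective (fun j => ⟨f j, hmem j⟩) ⟨fun a b h => hinj f hf' (by simpa using h),
      fun u => ?_⟩, Finset.mem_univ _, rfl⟩
    obtain ⟨j, -, hj⟩ := Finset.mem_image.mp (hf'.symm ▸ u.2 : (u : ι) ∈ Finset.univ.image f)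
    exact ⟨j, Subtype.ext hj⟩

/-- Each nonzero tensor entry in row `i` determines one edge at `i`, and grouping the tuples by that
edge replaces the tensor by an edge sum of the shape found in the vertex recurrence. -/
lemma adjTensor_apply {r : ℕ} (H : Hypergraph α) (hfin : V(H).Finite)
    (hunif : H.IsUniform r) (x : α → ℂ) (i : V(H)) :
    (adjTensor r H).apply (fun j => x j) i =
      ∑ e ∈ starOn (edgeSystem H) hfin.toFinset i, ∏ j ∈ e.erase i, x j := by
  have : Fintype V(H) := hfin.fintype
  have hcard : ∀ e ∈ edgeSystem H, e.card = r := by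
    intro e he
    have := hunif _ he
    rw [Set.encard_coe_eq_coe_finsetCard] at this
    exact_mod_cast this
  have hmem : ∀ f : Fin (r - 1) → V(H), ∀ e ∈ starOn (edgeSystem H) hfin.toFinset i,
      (insert (i : α) (Set.range fun j => (f j : α)) = (e : Set α) ↔
        Finset.univ.image f = (e.erase i).subtype (· ∈ V(H))) := by
    intro f e he
    obtain ⟨heV, heE, hie⟩ := mem_starOn.mp he
    have hsc : ((e.erase i).subtype (· ∈ V(H))).card = r - 1 := by
      rw [Finset.card_subtype, Finset.filter_true_of_mem, Finset.card_erase_of_mem hie, hcard e heE]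
      intro u hu
      simpa using heV (Finset.mem_of_mem_erase hu)
    constructor
    · intro h
      symm
      -- The count excludes `i` from the range of `f`: `r - 1` entries must already cover the `r -
      -- 1` other vertices of `e`.
      refine Finset.eq_of_subset_of_card_le ?_ ?_
      · intro u hu
        simp only [Finset.mem_subtype, Finset.mem_erase] at hu
        have : (u : α) ∈ insert (i : α) (Set.range fun j => (f j : α)) := by
          rw [h]; exact hu.2
        rcases this with h' | ⟨j, hj⟩
        · exact absurd h' hu.1
        · exact Finset.mem_image.mpr ⟨j, Finset.mem_univ _, Subtype.ext hj⟩
      · rw [hsc]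
        exact Finset.card_image_le.trans (by simp)
    · intro h
      ext u
      simp only [Set.mem_insert_iff, Set.mem_range, Finset.mem_coe]
      constructor
      · rintro (rfl | ⟨j, rfl⟩)
        · exact hie
        · have : f j ∈ (e.erase i).subtype (· ∈ V(H)) :=
            h ▸ Finset.mem_image_of_mem f (Finset.mem_univ j)
          simp only [Finset.mem_subtype, Finset.mem_erase] at this
          exact this.2
      · intro hu
        by_cases hui : u = i
        · exact Or.inl hui
        · right
          have huV : u ∈ V(H) := by simpa using heV hu
          have : (⟨u, huV⟩ : V(H)) ∈ Finset.univ.image f := by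
            rw [h]; simp [hui, hu]
          obtain ⟨j, -, hj⟩ := Finset.mem_image.mp this
          exact ⟨j, by rw [hj]⟩
  have hterm : ∀ f : Fin (r - 1) → V(H),
      ((adjTensor r H i f : ℝ) : ℂ) * ∏ j, x (f j) =
      ∑ e ∈ starOn (edgeSystem H) hfin.toFinset i,
        if Finset.univ.image f = (e.erase i).subtype (· ∈ V(H)) then
          (1 / ((r - 1).factorial : ℂ)) * ∏ j, x (f j) else 0 := by
    intro f
    unfold adjTensor
    split_ifs with hf
    · set e : Finset α := insert (i : α) (Finset.univ.image fun j => (f j : α)) with he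
      have hecoe : (e : Set α) = insert (i : α) (Set.range fun j => (f j : α)) := by
        simp [he]
      have hes : e ∈ starOn (edgeSystem H) hfin.toFinset i := by
        rw [mem_starOn, mem_edgeSystem, hecoe]
        refine ⟨?_, hf, Finset.mem_insert_self _ _⟩
        intro u hu
        rw [Set.Finite.mem_toFinset]
        exact mem_vertexSet_of_mem_edgeSet hf (hecoe ▸ hu)
      rw [Finset.sum_eq_single e, if_pos ((hmem f e hes).mp hecoe.symm)]
      · push_cast; rfl
      · intro e' he' hne
        refine if_neg fun h => hne ?_
        exact Finset.coe_injective (((hmem f e' he').mpr h).symm.trans hecoe.symm)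
      · exact fun h => absurd hes h
    · rw [Complex.ofReal_zero, zero_mul]
      symm
      refine Finset.sum_eq_zero fun e he => if_neg fun h => hf ?_
      rw [(hmem f e he).mpr h]
      exact (mem_starOn.mp he).2.1
  rw [RealTensor.apply, finsum_eq_sum_of_fintype, Finset.sum_congr rfl fun f _ => hterm f,
    Finset.sum_comm]
  refine Finset.sum_congr rfl fun e he => ?_
  obtain ⟨heV, heE, hie⟩ := mem_starOn.mp he
  have hsub : ∀ u ∈ e.erase (i : α), u ∈ V(H) := fun u hu => by
    simpa using heV (Finset.mem_of_mem_erase hu)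
  rw [← Finset.sum_filter, ← Finset.mul_sum,
    sum_prod_image_eq _ _ (fun j : V(H) => x j), Finset.prod_subtype_of_mem x hsub, ← mul_assoc,
    one_div, inv_mul_cancel₀ (by exact_mod_cast (Nat.factorial_pos _).ne'), one_mul]
  rw [Finset.card_subtype, Finset.filter_true_of_mem hsub, Finset.card_erase_of_mem hie,
    hcard e heE]

/-- The eigenvalue of a positive eigenvector is the spectral radius. -/
lemma spectralRadius_eq_of_pos_eigenvector {r : ℕ} (H : Hypergraph α)
    (hfin : V(H).Finite) (hne : V(H).Nonempty) (hunif : H.IsUniform r) {l : ℝ} (hl : 0 ≤ l)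
    {y : α → ℝ} (hy : ∀ i ∈ V(H), 0 < y i)
    (heig : ∀ i ∈ V(H), ∑ e ∈ starOn (edgeSystem H) hfin.toFinset i, ∏ j ∈ e.erase i, y j =
      l * y i ^ (r - 1)) :
    spectralRadius r H = l := by
  refine IsGreatest.csSup_eq ⟨⟨l, ⟨fun j => (y j : ℂ), ?_, fun i => ?_⟩, ?_⟩, ?_⟩
  · obtain ⟨i, hi⟩ := hne
    intro h0
    have := congrFun h0 ⟨i, hi⟩
    simp only [Pi.zero_apply, Complex.ofReal_eq_zero] at this
    exact (hy i hi).ne' this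
  · rw [adjTensor_apply H hfin hunif fun j => (y j : ℂ)]
    have := heig i i.2
    change _ = (l : ℂ) * (y i : ℂ) ^ (r - 1)
    exact_mod_cast this
  · simp [abs_of_nonneg hl]
  · rintro t ⟨lam, ⟨x, hx, hlam⟩, rfl⟩
    have : Fintype V(H) := hfin.fintype
    set x' : α → ℂ := fun j => if h : j ∈ V(H) then x ⟨j, h⟩ else 0 with hx'
    have hxx : x = fun j : V(H) => x' j := by
      ext j; simp [hx']
    have : Nonempty V(H) := hne.to_subtype
    -- Scale `y` to the least multiple `t * y` dominating `‖x'‖`; equality holds at `i`, where the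
    -- two eigenvalue equations are compared.
    obtain ⟨i, hi⟩ := Finite.exists_max fun j : V(H) => ‖x' j‖ / y j
    set t := ‖x' i‖ / y i with ht
    have hle : ∀ j ∈ V(H), ‖x' j‖ ≤ t * y j := fun j hj =>
      (div_le_iff₀ (hy j hj)).mp (hi ⟨j, hj⟩)
    have htpos : 0 < t := by
      obtain ⟨j, hj⟩ := Function.ne_iff.mp hx
      rw [hxx] at hj
      have h1 : 0 < ‖x' j‖ := norm_pos_iff.mpr (by simpa using hj)
      exact pos_of_mul_pos_left (h1.trans_le (hle j j.2)) (hy j j.2).le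
    have hi' : ‖x' i‖ = t * y i := by rw [ht, div_mul_cancel₀ _ (hy i i.2).ne']
    have h1 := hlam i
    rw [hxx, adjTensor_apply H hfin hunif x'] at h1
    have h2 : ‖lam‖ * (t * y i) ^ (r - 1) ≤ l * (t * y i) ^ (r - 1) := by
      calc ‖lam‖ * (t * y i) ^ (r - 1) = ‖lam * x' i ^ (r - 1)‖ := by
            rw [norm_mul, norm_pow, hi']
        _ = ‖∑ e ∈ starOn (edgeSystem H) hfin.toFinset i, ∏ j ∈ e.erase (i : α), x' j‖ := by rw [h1]
        _ ≤ ∑ e ∈ starOn (edgeSystem H) hfin.toFinset i,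
              t ^ (r - 1) * ∏ j ∈ e.erase (i : α), y j := by
            refine norm_sum_le_of_le _ fun e he => ?_
            obtain ⟨heV, heE, hie⟩ := mem_starOn.mp he
            have hec : (e.erase (i : α)).card = r - 1 := by
              have := hunif _ heE
              rw [Set.encard_coe_eq_coe_finsetCard] at this
              rw [Finset.card_erase_of_mem hie]
              congr 1
              exact_mod_cast this
            rw [norm_prod, ← hec, ← Finset.prod_const, ← Finset.prod_mul_distrib]
            refine Finset.prod_le_prod (fun _ _ => norm_nonneg _) fun j hj => hle j ?_
            simpa using heV (Finset.mem_of_mem_erase hj)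
        _ = l * (t * y i) ^ (r - 1) := by
            rw [← Finset.mul_sum, heig i i.2, mul_pow]; ring
    exact le_of_mul_le_mul_right h2 (pow_pos (mul_pos htpos (hy i i.2)) _)

end Spectral

/-! ### Acyclicity and connectedness in terms of cuts -/

section Cuts

variable {α : Type*} {H : Hypergraph α}

/-- `v 0, e 0, …, v l` is a walk from `a` to `b` that uses only members of `F`. -/
def Chain (F : Set (Set α)) (a b : α) (l : ℕ) (v : ℕ → α) (e : ℕ → Set α) : Prop :=
  v 0 = a ∧ v l = b ∧ ∀ k < l, e k ∈ F ∧ v k ∈ e k ∧ v (k + 1) ∈ e k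

/-- Cut out the vertices `v (m + 1), …, v n` and leave `v m` directly through `e n`, or stop there
if `n = l`. This form handles repeated vertices and repeated edges alike. -/
lemma Chain.shortcut {F : Set (Set α)} {a b : α} {l : ℕ} {v : ℕ → α} {e : ℕ → Set α}
    (h : Chain F a b l v e) {m n : ℕ} (hmn : m < n) (hn : n ≤ l) (h1 : n < l → v m ∈ e n)
    (h2 : n = l → v m = v l) : ∃ l' < l, ∃ v' e', Chain F a b l' v' e' := by
  obtain ⟨ha, hb, hc⟩ := h
  refine ⟨l - (n - m), by omega, fun k => if k ≤ m then v k else v (k + (n - m)),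
    fun k => if k < m then e k else e (k + (n - m)), ?_, ?_, ?_⟩
  · simpa using ha
  · by_cases hnl : n = l
    · have : l - (n - m) = m := by omega
      simp only [this, le_refl, if_true]
      rw [h2 hnl, hb]
    · have h3 : ¬ l - (n - m) ≤ m := by omega
      have h4 : l - (n - m) + (n - m) = l := by omega
      simp only [h3, if_false, h4, hb]
  · intro k hk
    rcases lt_trichotomy k m with hkm | rfl | hkm
    · have h3 : k ≤ m := hkm.le
      have h4 : k + 1 ≤ m := hkm
      simp only [hkm, h3, h4, if_true]
      exact hc k (by omega)
    · have h4 : ¬ k + 1 ≤ k := by omega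
      have h5 : k + (n - k) = n := by omega
      have h6 : k + 1 + (n - k) = n + 1 := by omega
      simp only [lt_irrefl, le_refl, h4, if_true, if_false, h5, h6]
      have := hc n (by omega)
      exact ⟨this.1, h1 (by omega), this.2.2⟩
    · have h3 : ¬ k ≤ m := by omega
      have h4 : ¬ k + 1 ≤ m := by omega
      have h5 : ¬ k < m := by omega
      have h6 : k + 1 + (n - m) = k + (n - m) + 1 := by omega
      simp only [h3, h4, h5, if_false, h6]
      exact hc _ (by omega)

/-- A shortest chain repeats nothing, since any repetition admits a shortcut. -/
lemma exists_chain_injOn {F : Set (Set α)} {a b : α} (h : ∃ l v e, Chain F a b l v e) :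
    ∃ l v e, Chain F a b l v e ∧ Set.InjOn v (Set.Iic l) ∧ Set.InjOn e (Set.Iio l) := by
  classical
  have hspec := Nat.find_spec h
  have hmin : ∀ l' < Nat.find h, ¬ ∃ v e, Chain F a b l' v e := fun l' hl' => Nat.find_min h hl'
  set l := Nat.find h
  obtain ⟨v, e, hve⟩ := hspec
  have hv : ∀ m n, m < n → n ≤ l → v m ≠ v n := by
    intro m n hmn hn heq
    obtain ⟨l', hl', hc⟩ := hve.shortcut hmn hn (fun h => heq ▸ (hve.2.2 n h).2.1)
      (fun h => heq.trans (by rw [h]))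
    exact hmin l' hl' hc
  have he : ∀ m n, m < n → n < l → e m ≠ e n := by
    intro m n hmn hn heq
    obtain ⟨l', hl', hc⟩ := hve.shortcut hmn hn.le (fun h => heq ▸ (hve.2.2 m (hmn.trans h)).2.1)
      (fun h => absurd h hn.ne)
    exact hmin l' hl' hc
  refine ⟨l, v, e, hve, ?_, ?_⟩
  · intro m hm n hn heq
    rcases lt_trichotomy m n with h | h | h
    · exact absurd heq (hv m n h hn)
    · exact h
    · exact absurd heq.symm (hv n m h hm)
  · intro m hm n hn heq
    rcases lt_trichotomy m n with h | h | h
    · exact absurd heq (he m n h hn)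
    · exact h
    · exact absurd heq.symm (he n m h hm)

/-- Take for `C` the vertices reachable from `i` without using `e`. If `j` were among them, a
repetition-free chain from `i` to `j` closed up by `e` would be a cycle. -/
lemma IsSuperforest.separatesEdges (h : H.IsSuperforest) : SeparatesEdges E(H) := by
  intro e he i hi j hj hij
  refine ⟨{u | ∃ l v c, Chain (E(H) \ {e}) i u l v c}, ⟨0, fun _ => i, fun _ => ∅, rfl, rfl,
    by simp⟩, ?_, ?_⟩
  · intro hmem
    obtain ⟨l, v, c, ⟨h0, hl, hc⟩, hv, hcinj⟩ := exists_chain_injOn hmem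
    have hl0 : l ≠ 0 := by
      rintro rfl
      exact hij (h0.symm.trans hl)
    refine h (l + 1) (fun k => if k ≤ l then v k else i) (fun k => if k < l then c k else e)
      ⟨by omega, ⟨?_, ?_⟩, ?_, ?_, ?_⟩
    · simpa [h0] using mem_vertexSet_of_mem_edgeSet he hi
    · intro k hk
      rcases Nat.lt_succ_iff_lt_or_eq.mp hk with hk | rfl
      · have h1 : k ≤ l := hk.le
        have h2 : k + 1 ≤ l := hk
        simp only [hk, h1, h2, if_true]
        exact ⟨(hc k hk).1.1, (hc k hk).2⟩
      · simp [he, hl, hj, hi]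
    · simp [h0]
    · intro m hm n hn heq
      have hm' : m ≤ l := Nat.lt_succ_iff.mp hm
      have hn' : n ≤ l := Nat.lt_succ_iff.mp hn
      simp only [hm', hn', if_true] at heq
      exact hv hm' hn' heq
    · intro m hm n hn heq
      rcases Nat.lt_succ_iff_lt_or_eq.mp hm with hm | rfl <;>
        rcases Nat.lt_succ_iff_lt_or_eq.mp hn with hn | rfl
      · simp only [hm, hn, if_true] at heq
        exact hcinj hm hn heq
      · simp only [hm, lt_irrefl, if_true, if_false] at heq
        exact absurd heq (hc m hm).1.2
      · simp only [hn, lt_irrefl, if_true, if_false] at heq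
        exact absurd heq.symm (hc n hn).1.2
      · rfl
  · intro f hf hfe
    by_contra! hcon
    obtain ⟨h1, h2⟩ := hcon
    obtain ⟨u, huf, l, v, c, h0, hl, hc⟩ := Set.not_disjoint_iff.mp h2
    refine h1 fun u' hu' => ⟨l + 1, fun k => if k ≤ l then v k else u',
      fun k => if k < l then c k else f, by simpa using h0, by simp, ?_⟩
    intro k hk
    rcases Nat.lt_succ_iff_lt_or_eq.mp hk with hk | rfl
    · have h1 : k ≤ l := hk.le
      have h2 : k + 1 ≤ l := hk
      simp only [hk, h1, h2, if_true]
      exact hc k hk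
    · simp [hf, hfe, hl, huf, hu']

/-- On a cycle, the edges other than `e 0` lead from `v 1` back to `v 0` without crossing the set
that separates these two. This recovers acyclicity of the grafts from their cuts. -/
lemma SeparatesEdges.isSuperforest (h : SeparatesEdges E(H)) : H.IsSuperforest := by
  rintro l v e ⟨hl, ⟨-, hwalk⟩, hclose, hv, he⟩
  have h0 := hwalk 0 (by omega)
  have hne : v 1 ≠ v 0 := fun heq => by
    have := hv (show 1 < l by omega) (show 0 < l by omega) heq
    omega
  obtain ⟨C, hC1, hC0, hC⟩ := h (e 0) h0.1 (v 1) h0.2.2 (v 0) h0.2.1 hne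
  have hmem : ∀ k, k + 1 ≤ l → v (k + 1) ∈ C := by
    intro k
    induction k with
    | zero => exact fun _ => hC1
    | succ k ih =>
      intro hk
      have hk1 := hwalk (k + 1) (by omega)
      have hek : e (k + 1) ≠ e 0 := fun heq => by
        have := he (show k + 1 < l by omega) (show 0 < l by omega) heq
        omega
      rcases hC _ hk1.1 hek with h2 | h2
      · exact h2 hk1.2.2
      · exact absurd (ih (by omega)) (Set.disjoint_left.mp h2 hk1.2.1)
  have := hmem (l - 1) (by omega)
  rw [Nat.sub_add_cancel (by omega), hclose] at this
  exact hC0 this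

/-- A set of vertices that is not crossed by any edge contains all vertices or none. -/
def LinksVertices (H : Hypergraph α) : Prop :=
  ∀ W : Set α, (∀ e ∈ E(H), ∀ a ∈ e, a ∈ W → e ⊆ W) → ∀ a ∈ V(H), ∀ b ∈ V(H), a ∈ W → b ∈ W

lemma IsConnected.linksVertices (h : H.IsConnected) : H.LinksVertices := by
  intro W hW a ha b hb haW
  obtain ⟨l, v, e, ⟨⟨-, hwalk⟩, -, -⟩, h0, hl⟩ := h a ha b hb
  have : ∀ k ≤ l, v k ∈ W := by
    intro k
    induction k with
    | zero => exact fun _ => h0 ▸ haW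
    | succ k ih =>
      intro hk
      obtain ⟨h1, h2, h3⟩ := hwalk k hk
      exact hW _ h1 _ h2 (ih (by omega)) h3
  exact hl ▸ this l le_rfl

/-! ### Gluing two hypergraphs at a vertex -/

/-- `K` is the union of copies of `G` and `H`, embedded by `f` and `g`, that share exactly the vertex
`f u = g w`. -/
structure IsGluing {α β γ : Type*} (K : Hypergraph γ) (G : Hypergraph α) (H : Hypergraph β)
    (f : α ↪ γ) (g : β ↪ γ) (u : α) (w : β) : Prop where
  vertexSet_eq : V(K) = f '' V(G) ∪ g '' V(H)
  edgeSet_eq : E(K) = (fun e => f '' e) '' E(G) ∪ (fun e => g '' e) '' E(H)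
  eq_iff : ∀ a b, f a = g b ↔ a = u ∧ b = w
  left_mem : u ∈ V(G)
  right_mem : w ∈ V(H)

namespace IsGluing

variable {β γ : Type*} {K : Hypergraph γ} {G : Hypergraph α} {H : Hypergraph β}
  {f : α ↪ γ} {g : β ↪ γ} {u : α} {w : β}

lemma symm (h : IsGluing K G H f g u w) : IsGluing K H G g f w u where
  vertexSet_eq := by rw [h.vertexSet_eq, Set.union_comm]
  edgeSet_eq := by rw [h.edgeSet_eq, Set.union_comm]
  eq_iff a b := by rw [eq_comm, h.eq_iff, and_comm]
  left_mem := h.right_mem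
  right_mem := h.left_mem

lemma glue_eq (h : IsGluing K G H f g u w) : f u = g w := (h.eq_iff u w).mpr ⟨rfl, rfl⟩

/-- Extend a separating set of `G` by the whole copy of `H` if it contains `u`, and by nothing
otherwise; no edge of `H` is then crossed. -/
lemma separates_left (h : IsGluing K G H f g u w) (hG : SeparatesEdges E(G)) {e : Set α}
    (he : e ∈ E(G)) {i j : γ} (hi : i ∈ f '' e) (hj : j ∈ f '' e) (hij : i ≠ j) :
    ∃ C : Set γ, i ∈ C ∧ j ∉ C ∧ ∀ c ∈ E(K), c ≠ f '' e → c ⊆ C ∨ Disjoint c C := by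
  obtain ⟨i, hi, rfl⟩ := hi
  obtain ⟨j, hj, rfl⟩ := hj
  obtain ⟨C, hiC, hjC, hC⟩ := hG e he i hi j hj fun h => hij (by rw [h])
  have hmem : ∀ a, (f a ∈ {c | (∃ a ∈ C, f a = c) ∨ (u ∈ C ∧ c ∈ Set.range g)}) ↔ a ∈ C := by
    intro a
    constructor
    · rintro (⟨a', ha', h1⟩ | ⟨hu, b, hb⟩)
      · rwa [← f.injective h1]
      · rwa [((h.eq_iff a b).mp hb.symm).1]
    · exact fun ha => Or.inl ⟨a, ha, rfl⟩
  have hmem' : ∀ b, (g b ∈ {c | (∃ a ∈ C, f a = c) ∨ (u ∈ C ∧ c ∈ Set.range g)}) ↔ u ∈ C := by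
    intro b
    constructor
    · rintro (⟨a', ha', h1⟩ | ⟨hu, -⟩)
      · rwa [← ((h.eq_iff a' b).mp h1).1]
      · exact hu
    · exact fun hu => Or.inr ⟨hu, b, rfl⟩
  refine ⟨{c | (∃ a ∈ C, f a = c) ∨ (u ∈ C ∧ c ∈ Set.range g)}, (hmem i).mpr hiC,
    fun hj' => hjC ((hmem j).mp hj'), ?_⟩
  intro c hc hce
  rw [h.edgeSet_eq] at hc
  rcases hc with ⟨c, hc, rfl⟩ | ⟨c, hc, rfl⟩
  · rcases hC c hc fun h => hce (by rw [h]) with h1 | h1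
    · left
      rintro _ ⟨a, ha, rfl⟩
      exact (hmem a).mpr (h1 ha)
    · right
      rw [Set.disjoint_left]
      rintro _ ⟨a, ha, rfl⟩ h2
      exact Set.disjoint_left.mp h1 ha ((hmem a).mp h2)
  · by_cases hu : u ∈ C
    · left
      rintro _ ⟨b, -, rfl⟩
      exact (hmem' b).mpr hu
    · right
      rw [Set.disjoint_left]
      rintro _ ⟨b, -, rfl⟩ h2
      exact hu ((hmem' b).mp h2)

lemma separatesEdges (h : IsGluing K G H f g u w) (hG : SeparatesEdges E(G))
    (hH : SeparatesEdges E(H)) : SeparatesEdges E(K) := by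
  intro e he i hi j hj hij
  have he' := he
  rw [h.edgeSet_eq] at he'
  rcases he' with ⟨e, he0, rfl⟩ | ⟨e, he0, rfl⟩
  · exact h.separates_left hG he0 hi hj hij
  · exact h.symm.separates_left hH he0 hi hj hij

lemma linksVertices (h : IsGluing K G H f g u w) (hG : G.LinksVertices) (hH : H.LinksVertices) :
    K.LinksVertices := by
  intro W hW
  have h1 := hG (f ⁻¹' W) fun e he a ha haW => Set.image_subset_iff.mp
    (hW (f '' e) (h.edgeSet_eq ▸ Or.inl ⟨e, he, rfl⟩) (f a) ⟨a, ha, rfl⟩ haW)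
  have h2 := hH (g ⁻¹' W) fun e he a ha haW => Set.image_subset_iff.mp
    (hW (g '' e) (h.edgeSet_eq ▸ Or.inr ⟨e, he, rfl⟩) (g a) ⟨a, ha, rfl⟩ haW)
  have hu := h.left_mem
  have hw := h.right_mem
  have key : ∀ c ∈ V(K), c ∈ W ↔ f u ∈ W := by
    intro c hc
    rw [h.vertexSet_eq] at hc
    rcases hc with ⟨a, ha, rfl⟩ | ⟨b, hb, rfl⟩
    · exact ⟨h1 a ha u hu, h1 u hu a ha⟩
    · rw [h.glue_eq]
      exact ⟨h2 b hb w hw, h2 w hw b hb⟩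
  exact fun a ha b hb haW => (key b hb).mpr ((key a ha).mp haW)

lemma isUniform (h : IsGluing K G H f g u w) {r : ℕ} (hG : G.IsUniform r) (hH : H.IsUniform r) :
    K.IsUniform r := by
  intro e he
  rw [h.edgeSet_eq] at he
  rcases he with ⟨e, he, rfl⟩ | ⟨e, he, rfl⟩
  · exact (f.injective.encard_image e).trans (hG e he)
  · exact (g.injective.encard_image e).trans (hH e he)

lemma finite (h : IsGluing K G H f g u w) (hG : V(G).Finite) (hH : V(H).Finite) : V(K).Finite := by
  rw [h.vertexSet_eq]
  exact (hG.image f).union (hH.image g)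

end IsGluing

open Classical in
/-- The embedding of the second hypergraph into a coalescence. -/
def glueRight {β : Type*} (u : α) (w : β) : β ↪ α ⊕ β where
  toFun b := if b = w then Sum.inl u else Sum.inr b
  inj' := by
    intro a b hab
    by_cases ha : a = w <;> by_cases hb : b = w <;> simp_all

lemma isGluing_coalescence {β : Type*} (G : Hypergraph α) (u : α) (H : Hypergraph β) (w : β)
    (hu : u ∈ V(G)) (hw : w ∈ V(H)) :
    IsGluing (coalescence G u H w) G H ⟨Sum.inl, Sum.inl_injective⟩ (glueRight u w) u w where
  vertexSet_eq := rfl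
  edgeSet_eq := rfl
  eq_iff a b := by
    classical
    change Sum.inl a = (if b = w then Sum.inl u else Sum.inr b) ↔ _
    by_cases hb : b = w <;> simp [hb]
  left_mem := hu
  right_mem := hw

/-! ### Loose paths -/

lemma finite_loosePath (r m : ℕ) : V(loosePath r m).Finite := Set.finite_Iic _

lemma isUniform_loosePath {r : ℕ} (hr : 1 ≤ r) (m : ℕ) : (loosePath r m).IsUniform r := by
  rintro e ⟨i, -, rfl⟩
  rw [← Finset.coe_Icc, Set.encard_coe_eq_coe_finsetCard, Nat.card_Icc, add_mul]
  congr 1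
  omega

/-- Blocks are intervals overlapping at most in end points, so the initial segment up to `i` (if `i
< j`) or the final segment from `i` (if `j < i`) is crossed by no other block. -/
lemma separatesEdges_loosePath (r m : ℕ) : SeparatesEdges E(loosePath r m) := by
  have hblock : ∀ {a b : ℕ}, a < b → (a + 1) * (r - 1) ≤ b * (r - 1) := fun h =>
    Nat.mul_le_mul_right _ h
  rintro _ ⟨k, hk, rfl⟩ i ⟨hi1, hi2⟩ j ⟨hj1, hj2⟩ hij
  rcases lt_or_gt_of_ne hij with hlt | hlt
  · refine ⟨Set.Iic i, Set.self_mem_Iic, not_le.mpr hlt, ?_⟩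
    rintro _ ⟨n, hn, rfl⟩ hne
    rcases lt_trichotomy n k with h | rfl | h
    · exact Or.inl fun a ha => ha.2.trans ((hblock h).trans hi1)
    · exact absurd rfl hne
    · refine Or.inr (Set.disjoint_left.mpr fun a ha ha' => ?_)
      exact absurd (hlt.trans_le (hj2.trans ((hblock h).trans ha.1))) (not_lt.mpr ha')
  · refine ⟨Set.Ici i, Set.self_mem_Ici, not_le.mpr hlt, ?_⟩
    rintro _ ⟨n, hn, rfl⟩ hne
    rcases lt_trichotomy n k with h | rfl | h
    · refine Or.inr (Set.disjoint_left.mpr fun a ha ha' => ?_)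
      exact absurd ((ha.2.trans ((hblock h).trans hj1)).trans_lt hlt) (not_lt.mpr ha')
    · exact absurd rfl hne
    · exact Or.inl fun a ha => hi2.trans ((hblock h).trans ha.1)

/-- Consecutive vertices `k` and `k + 1` share the block of index `k / (r - 1)`. -/
lemma linksVertices_loosePath {r : ℕ} (hr : 2 ≤ r) (m : ℕ) : (loosePath r m).LinksVertices := by
  intro W hW
  have hstep : ∀ k, k + 1 ≤ m * (r - 1) → (k ∈ W ↔ k + 1 ∈ W) := by
    intro k hk
    have hs : 0 < r - 1 := by omega
    have h1 : k / (r - 1) * (r - 1) ≤ k := Nat.div_mul_le_self _ _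
    have h2 : k < (k / (r - 1) + 1) * (r - 1) := by
      rw [← Nat.div_lt_iff_lt_mul hs]; omega
    have hmem : Set.Icc (k / (r - 1) * (r - 1)) ((k / (r - 1) + 1) * (r - 1)) ∈
        E(loosePath r m) := ⟨k / (r - 1), by rw [Nat.div_lt_iff_lt_mul hs]; omega, rfl⟩
    exact ⟨fun h => hW _ hmem k ⟨h1, h2.le⟩ h ⟨by omega, h2⟩,
      fun h => hW _ hmem (k + 1) ⟨by omega, h2⟩ h ⟨h1, h2.le⟩⟩
  have key : ∀ k ≤ m * (r - 1), (k ∈ W ↔ 0 ∈ W) := by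
    intro k
    induction k with
    | zero => exact fun _ => Iff.rfl
    | succ k ih => exact fun hk => (hstep k hk).symm.trans (ih (by omega))
  exact fun a ha b hb haW => (key b hb).mpr ((key a ha).mp haW)

end Cuts

/-! ### From hypergraphs to set systems -/

section Evaluation

open Classical

variable {α : Type*}

lemma IsUniform.card_eq {H : Hypergraph α} {r : ℕ} (h : H.IsUniform r) {e : Finset α}
    (he : e ∈ edgeSystem H) : e.card = r := by
  have := h _ he
  rw [Set.encard_coe_eq_coe_finsetCard] at this
  exact_mod_cast this

lemma IsUniform.empty_notMem {H : Hypergraph α} {r : ℕ} (h : H.IsUniform r) (hr : 0 < r) :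
    ∅ ∉ edgeSystem H := fun h0 => by simpa [hr.ne] using h.card_eq h0

namespace IsGluing

variable {β γ : Type*} {K : Hypergraph γ} {G : Hypergraph α} {H : Hypergraph β}
  {f : α ↪ γ} {g : β ↪ γ} {u : α} {w : β} {r : ℕ}

/-- The copies share a single vertex, so an edge of `H`, having at least two vertices, cannot lie in
the copy of `G`. Thus gluing creates no new edges on either side. -/
lemma map_mem_edgeSystem (h : IsGluing K G H f g u w) (hr : 2 ≤ r) (hH : H.IsUniform r)
    (e : Finset α) : e.map f ∈ edgeSystem K ↔ e ∈ edgeSystem G := by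
  rw [mem_edgeSystem, mem_edgeSystem, h.edgeSet_eq, Finset.coe_map]
  constructor
  · rintro (⟨c, hc, hce⟩ | ⟨c, hc, hce⟩)
    · rwa [← f.injective.image_injective hce]
    · exfalso
      have hsub : c ⊆ {w} := by
        intro b hb
        obtain ⟨a, -, ha⟩ : g b ∈ f '' (e : Set α) := hce ▸ ⟨b, hb, rfl⟩
        exact ((h.eq_iff a b).mp ha).2
      have := Set.encard_le_encard hsub
      rw [hH c hc, Set.encard_singleton] at this
      have : r ≤ 1 := by exact_mod_cast this
      omega
  · exact fun he => Or.inl ⟨_, he, rfl⟩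

lemma exists_map (h : IsGluing K G H f g u w) {e : Finset γ} (he : e ∈ edgeSystem K) :
    (∃ c ∈ edgeSystem G, c.map f = e) ∨ ∃ c ∈ edgeSystem H, c.map g = e := by
  rw [mem_edgeSystem, h.edgeSet_eq] at he
  rcases he with ⟨c, hc, hce⟩ | ⟨c, hc, hce⟩
  · have hfin : c.Finite := Set.Finite.of_finite_image (f := f)
      (by simpa only [hce] using e.finite_toSet) f.injective.injOn
    refine Or.inl ⟨hfin.toFinset, by simpa [mem_edgeSystem] using hc, ?_⟩
    rw [← Finset.coe_inj, Finset.coe_map, Set.Finite.coe_toFinset]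
    exact hce
  · have hfin : c.Finite := Set.Finite.of_finite_image (f := g)
      (by simpa only [hce] using e.finite_toSet) g.injective.injOn
    refine Or.inr ⟨hfin.toFinset, by simpa [mem_edgeSystem] using hc, ?_⟩
    rw [← Finset.coe_inj, Finset.coe_map, Set.Finite.coe_toFinset]
    exact hce

lemma disjoint_map (h : IsGluing K G H f g u w) {A : Finset α} {B : Finset β}
    (hAB : u ∉ A ∨ w ∉ B) : Disjoint (A.map f) (B.map g) := by
  rw [Finset.disjoint_left]
  intro c hc hc'
  obtain ⟨a, ha, rfl⟩ := Finset.mem_map.mp hc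
  obtain ⟨b, hb, hab⟩ := Finset.mem_map.mp hc'
  obtain ⟨rfl, rfl⟩ := (h.eq_iff a b).mp hab.symm
  exact hAB.elim (fun h => h ha) (fun h => h hb)

lemma toFinset_eq [DecidableEq γ] (h : IsGluing K G H f g u w) (hK : V(K).Finite) (hG : V(G).Finite)
    (hH : V(H).Finite) : hK.toFinset = hG.toFinset.map f ∪ hH.toFinset.map g := by
  ext z
  simp [h.vertexSet_eq]

end IsGluing

variable [DecidableEq α]

lemma matchingCount_eq (H : Hypergraph α) (hfin : V(H).Finite) (k : ℕ) :
    H.matchingCount k =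
      ((matchingsOn (edgeSystem H) hfin.toFinset).filter fun M => M.card = k).card := by
  have hinj : Function.Injective fun M : Finset (Finset α) =>
      (fun e : Finset α => (e : Set α)) '' (M : Set (Finset α)) := fun M N h =>
    Finset.coe_injective (Finset.coe_injective.image_injective h)
  rw [matchingCount, ← Set.ncard_coe_finset, ← Set.ncard_image_of_injective _ hinj]
  congr 1
  ext N
  simp only [Set.mem_ofPred_eq, Set.mem_image, Finset.mem_coe, Finset.mem_filter, mem_matchingsOn]
  constructor
  · rintro ⟨h1, h2, h3⟩
    have hNM : (fun e : Finset α => (e : Set α)) ''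
        ((hfin.toFinset.powerset.filter fun e : Finset α => (e : Set α) ∈ N : Finset (Finset α)) :
          Set (Finset α)) = N := by
      ext c
      simp only [Set.mem_image, Finset.mem_coe, Finset.mem_filter]
      constructor
      · rintro ⟨e, ⟨-, he⟩, rfl⟩
        exact he
      · intro hc
        have hcV := subset_vertexSet_of_mem_edgeSet (h1 hc)
        refine ⟨(hfin.subset hcV).toFinset, ⟨?_, by simpa using hc⟩, by simp⟩
        rw [Finset.mem_powerset]
        exact Set.Finite.toFinset_mono hcV
    refine ⟨_, ⟨⟨fun e he => ?_, fun e he f hf hef => ?_⟩, ?_⟩, hNM⟩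
    · obtain ⟨heV, heN⟩ := Finset.mem_filter.mp he
      exact ⟨Finset.mem_powerset.mp heV, h1 heN⟩
    · have heN := (Finset.mem_filter.mp he).2
      have hfN := (Finset.mem_filter.mp hf).2
      rw [Finset.disjoint_left]
      exact fun u hue huf => h2 heN hfN (fun h => hef (Finset.coe_injective h))
        ⟨h1 heN, h1 hfN, u, hue, huf⟩
    · rw [← hNM, Finset.coe_injective.injOn.encard_image, Set.encard_coe_eq_coe_finsetCard] at h3
      exact_mod_cast h3
  · rintro ⟨M, ⟨⟨h1, h2⟩, h3⟩, rfl⟩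
    refine ⟨?_, ?_, ?_⟩
    · rintro _ ⟨e, he, rfl⟩
      exact (h1 e he).2
    · rintro _ ⟨e, he, rfl⟩ _ ⟨f, hf, rfl⟩ hef ⟨-, -, u, hue, huf⟩
      exact Finset.disjoint_left.mp (h2 e he f hf fun h => hef (by rw [h])) hue huf
    · rw [Finset.coe_injective.injOn.encard_image, Set.encard_coe_eq_coe_finsetCard, h3]

/-- Group the matchings by size: by uniformity `k` disjoint edges leave exactly n − kr vertices
uncovered. -/
lemma eval_matchingPoly {r : ℕ} (hr : 0 < r) (H : Hypergraph α) (hfin : V(H).Finite)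
    (hunif : H.IsUniform r) (x : ℝ) :
    (matchingPoly r H).eval x = matchEval (edgeSystem H) hfin.toFinset x := by
  have hcov : ∀ M ∈ matchingsOn (edgeSystem H) hfin.toFinset,
      (M.biUnion id).card = M.card * r ∧ M.biUnion id ⊆ hfin.toFinset := by
    intro M hM
    obtain ⟨h1, h2⟩ := mem_matchingsOn.mp hM
    constructor
    · rw [Finset.card_biUnion (t := id) h2]
      exact Finset.sum_const_nat fun e he => hunif.card_eq (h1 e he).2
    · exact Finset.biUnion_subset.mpr fun e he => (h1 e he).1
  have hn : V(H).ncard = hfin.toFinset.card := Set.ncard_eq_toFinset_card _ hfin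
  rw [matchEval, matchingPoly, Polynomial.eval_finsetSum, ← Finset.sum_fiberwise_of_maps_to
    (s := matchingsOn (edgeSystem H) hfin.toFinset) (t := Finset.range (V(H).ncard + 1))
    (g := Finset.card)]
  · refine Finset.sum_congr rfl fun k _ => ?_
    rw [matchingCount_eq H hfin, Polynomial.eval_mul, Polynomial.eval_C, Polynomial.eval_pow,
      Polynomial.eval_X, mul_right_comm, mul_comm, ← nsmul_eq_mul]
    symm
    refine Finset.sum_eq_card_nsmul fun M hM => ?_
    obtain ⟨hM', rfl⟩ := Finset.mem_filter.mp hM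
    rw [Finset.card_sdiff_of_subset (hcov M hM').2, (hcov M hM').1, hn]
  · intro M hM
    rw [Finset.mem_range, Nat.lt_succ_iff, hn]
    exact (Nat.le_mul_of_pos_right _ hr).trans
      ((hcov M hM).1 ▸ Finset.card_le_card (hcov M hM).2)

/-- The spectral radius of an acyclic connected uniform hypergraph with an edge is the largest root of
its matching polynomial, and exceeds all roots of those of its proper induced subsystems. -/
theorem spectralRadius_eq_largest_root {r : ℕ} (hr : 2 ≤ r) (H : Hypergraph α)
    (hfin : V(H).Finite) (hunif : H.IsUniform r) (hsep : SeparatesEdges E(H))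
    (hlink : H.LinksVertices) (hedge : E(H).Nonempty) :
    1 ≤ spectralRadius r H ∧
    matchEval (edgeSystem H) hfin.toFinset (spectralRadius r H) = 0 ∧
    (∀ x > spectralRadius r H, 0 < matchEval (edgeSystem H) hfin.toFinset x) ∧
    ∀ W ⊂ hfin.toFinset, ∀ x ≥ spectralRadius r H, 0 < matchEval (edgeSystem H) W x := by
  have hE := hunif.empty_notMem (by omega)
  obtain ⟨e₀, he₀⟩ := hedge
  have he₀V := subset_vertexSet_of_mem_edgeSet he₀
  -- A proper nonempty vertex set crossed by no edge would contradict `hlink`.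
  have hconn : ∀ W ⊂ hfin.toFinset, W.Nonempty →
      ∃ e ∈ edgeSystem H, e ⊆ hfin.toFinset ∧ ¬ e ⊆ W ∧ ¬ Disjoint e W := by
    rintro W hW ⟨a, ha⟩
    by_contra! hcon
    obtain ⟨b, hb, hbW⟩ := Finset.exists_of_ssubset hW
    refine hbW (hlink (W : Set α) ?_ a (by simpa using hW.1 ha) b (by simpa using hb) ha)
    intro e he c hce hcW
    have heV := subset_vertexSet_of_mem_edgeSet he
    by_contra hsub
    have := hcon (hfin.subset heV).toFinset (by simpa [mem_edgeSystem] using he)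
      (Set.Finite.toFinset_mono heV) (by
        rwa [← Finset.coe_subset, Set.Finite.coe_toFinset])
    exact Finset.disjoint_left.mp this (by simpa using hce) hcW
  obtain ⟨l, hl1, hroot, habove⟩ := exists_largest_root_of_uniform (r := r) (by omega)
    (fun e he => hunif.card_eq he) (V := hfin.toFinset) (e := (hfin.subset he₀V).toFinset)
    (by simpa [mem_edgeSystem] using he₀) (Set.Finite.toFinset_mono he₀V)
  have hpos : ∀ W ⊂ hfin.toFinset, 0 < matchEval (edgeSystem H) W l := fun W hW =>
    matchEval_pos_of_ssubset hE hW hconn habove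
  obtain ⟨y, hy, heig⟩ := exists_pos_eigenvector (r := r) (by omega)
    (fun e he => hunif.card_eq he) hroot hpos (fun e he i hi j hj hij => by
      obtain ⟨C, h1, h2, h3⟩ := hsep e he i hi j hj hij
      exact ⟨C, h1, h2, fun f hf hfe => h3 f hf fun h => hfe (Finset.coe_injective h)⟩)
  have hne : V(H).Nonempty := by
    have : 0 < e₀.encard := by rw [hunif e₀ he₀]; exact_mod_cast (by omega : 0 < r)
    exact (Set.encard_pos.mp this).mono he₀V
  have hrho : spectralRadius r H = l :=
    spectralRadius_eq_of_pos_eigenvector H hfin hne hunif (by linarith)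
      (fun i hi => hy i (by simpa using hi)) (fun i hi => heig i (by simpa using hi))
  rw [hrho]
  refine ⟨hl1, hroot, habove, fun W hW x hx => ?_⟩
  rcases eq_or_lt_of_le hx with rfl | hx
  · exact hpos W hW
  · exact matchEval_pos_above_of_subset hE hW.1 habove x hx

/-! ### The matching polynomial of a gluing -/

namespace IsGluing

variable {β γ : Type*} [DecidableEq γ] {K : Hypergraph γ} {G : Hypergraph α} {H : Hypergraph β}
  {f : α ↪ γ} {g : β ↪ γ} {u : α} {w : β} {r : ℕ}

lemma matchEval_map_left (h : IsGluing K G H f g u w) (hr : 2 ≤ r) (hG : G.IsUniform r)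
    (hH : H.IsUniform r) (W : Finset α) (x : ℝ) :
    matchEval (edgeSystem K) (W.map f) x = matchEval (edgeSystem G) W x :=
  matchEval_map f (hG.empty_notMem (by omega)) W (fun e _ => h.map_mem_edgeSystem hr hH e) x

variable [DecidableEq β]

/-- Without the common vertex a gluing is a disjoint union. -/
lemma matchEval_disjoint (h : IsGluing K G H f g u w) (hr : 2 ≤ r) (hG : G.IsUniform r)
    (hH : H.IsUniform r) {A : Finset α} {B : Finset β} (hA : u ∉ A) (hB : w ∉ B) (x : ℝ) :
    matchEval (edgeSystem K) (A.map f ∪ B.map g) x =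
      matchEval (edgeSystem G) A x * matchEval (edgeSystem H) B x := by
  rw [matchEval_union ((h.isUniform hG hH).empty_notMem (by omega)) _ _
    (h.disjoint_map (Or.inl hA)), h.matchEval_map_left hr hG hH,
    h.symm.matchEval_map_left hr hH hG]
  intro e he hsub
  rcases h.exists_map he with ⟨c, -, rfl⟩ | ⟨c, -, rfl⟩
  · left
    intro z hz
    obtain ⟨a, ha, rfl⟩ := Finset.mem_map.mp hz
    refine (Finset.mem_union.mp (hsub hz)).resolve_right fun hz' => hB ?_
    obtain ⟨b, hb, hab⟩ := Finset.mem_map.mp hz'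
    exact ((h.eq_iff a b).mp hab.symm).2 ▸ hb
  · right
    intro z hz
    obtain ⟨b, hb, rfl⟩ := Finset.mem_map.mp hz
    refine (Finset.mem_union.mp (hsub hz)).resolve_left fun hz' => hA ?_
    obtain ⟨a, ha, hab⟩ := Finset.mem_map.mp hz'
    exact ((h.eq_iff a b).mp hab).1 ▸ ha

lemma starOn_union (h : IsGluing K G H f g u w) (hr : 2 ≤ r) (hG : G.IsUniform r)
    (hH : H.IsUniform r) (A : Finset α) (B : Finset β) (hA : u ∈ A) (hB : w ∈ B) :
    starOn (edgeSystem K) (A.map f ∪ B.map g) (f u) =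
      (starOn (edgeSystem G) A u).map (Finset.mapEmbedding f).toEmbedding ∪
      (starOn (edgeSystem H) B w).map (Finset.mapEmbedding g).toEmbedding := by
  ext e
  simp only [Finset.mem_union, mem_starOn, Finset.mem_map, RelEmbedding.coe_toEmbedding,
    Finset.mapEmbedding_apply]
  constructor
  · rintro ⟨h1, h2, h3⟩
    rcases h.exists_map h2 with ⟨c, hc, rfl⟩ | ⟨c, hc, rfl⟩
    · refine Or.inl ⟨c, ⟨fun a ha => ?_, hc, by simpa using h3⟩, rfl⟩
      rcases Finset.mem_union.mp (h1 (Finset.mem_map_of_mem f ha)) with h4 | h4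
      · simpa using h4
      · obtain ⟨b, -, hab⟩ := Finset.mem_map.mp h4
        exact ((h.eq_iff a b).mp hab.symm).1 ▸ hA
    · rw [h.glue_eq] at h3
      refine Or.inr ⟨c, ⟨fun b hb => ?_, hc, by simpa using h3⟩, rfl⟩
      rcases Finset.mem_union.mp (h1 (Finset.mem_map_of_mem g hb)) with h4 | h4
      · obtain ⟨a, -, hab⟩ := Finset.mem_map.mp h4
        exact ((h.eq_iff a b).mp hab).2 ▸ hB
      · simpa using h4
  · rintro (⟨c, ⟨h1, h2, h3⟩, rfl⟩ | ⟨c, ⟨h1, h2, h3⟩, rfl⟩)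
    · exact ⟨(Finset.map_subset_map.mpr h1).trans Finset.subset_union_left,
        (h.map_mem_edgeSystem hr hH c).mpr h2, Finset.mem_map_of_mem f h3⟩
    · exact ⟨(Finset.map_subset_map.mpr h1).trans Finset.subset_union_right,
        (h.symm.map_mem_edgeSystem hr hG c).mpr h2, h.glue_eq ▸ Finset.mem_map_of_mem g h3⟩

/-- Removing a set through `u` on one side also removes `w` on the other, because `f u = g w`;
nothing else is shared. -/
lemma map_union_sdiff (h : IsGluing K G H f g u w) (A : Finset α) (B : Finset β)
    {c : Finset α} (hu : u ∈ c) :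
    (A.map f ∪ B.map g) \ c.map f = (A \ c).map f ∪ (B.erase w).map g := by
  ext z
  simp only [Finset.mem_sdiff, Finset.mem_union, Finset.mem_map, Finset.mem_erase]
  constructor
  · rintro ⟨⟨a, ha, rfl⟩ | ⟨b, hb, rfl⟩, hz⟩
    · exact Or.inl ⟨a, ⟨ha, fun hac => hz ⟨a, hac, rfl⟩⟩, rfl⟩
    · refine Or.inr ⟨b, ⟨fun hbw => hz ⟨u, hu, ?_⟩, hb⟩, rfl⟩
      rw [hbw, h.glue_eq]
  · rintro (⟨a, ⟨ha, hac⟩, rfl⟩ | ⟨b, ⟨hbw, hb⟩, rfl⟩)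
    · exact ⟨Or.inl ⟨a, ha, rfl⟩, fun ⟨a', ha', h1⟩ => hac (f.injective h1 ▸ ha')⟩
    · exact ⟨Or.inr ⟨b, hb, rfl⟩, fun ⟨a', _, h1⟩ => hbw ((h.eq_iff a' b).mp h1).2⟩

lemma map_union_erase (h : IsGluing K G H f g u w) (A : Finset α) (B : Finset β) :
    (A.map f ∪ B.map g).erase (f u) = (A.erase u).map f ∪ (B.erase w).map g := by
  rw [Finset.erase_eq, ← Finset.map_singleton, h.map_union_sdiff A B
    (Finset.mem_singleton_self u), ← Finset.erase_eq]

/-- The matching polynomial of a gluing. -/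
lemma matchEval_gluing (h : IsGluing K G H f g u w) (hr : 2 ≤ r) (hG : G.IsUniform r)
    (hH : H.IsUniform r) {A : Finset α} {B : Finset β} (hA : u ∈ A) (hB : w ∈ B) (x : ℝ) :
    matchEval (edgeSystem K) (A.map f ∪ B.map g) x =
      matchEval (edgeSystem G) A x * matchEval (edgeSystem H) (B.erase w) x +
      matchEval (edgeSystem G) (A.erase u) x * matchEval (edgeSystem H) B x -
      x * matchEval (edgeSystem G) (A.erase u) x * matchEval (edgeSystem H) (B.erase w) x := by
  have hdis : Disjoint ((starOn (edgeSystem G) A u).map (Finset.mapEmbedding f).toEmbedding)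
      ((starOn (edgeSystem H) B w).map (Finset.mapEmbedding g).toEmbedding) := by
    rw [Finset.disjoint_left]
    intro e he he'
    simp only [Finset.mem_map, RelEmbedding.coe_toEmbedding, Finset.mapEmbedding_apply,
      mem_starOn] at he he'
    obtain ⟨c, ⟨-, hc, -⟩, rfl⟩ := he
    obtain ⟨c', ⟨-, hc', -⟩, hcc⟩ := he'
    have hsub : c ⊆ {u} := by
      intro a ha
      have : f a ∈ c'.map g := hcc ▸ Finset.mem_map_of_mem f ha
      obtain ⟨b, -, hb⟩ := Finset.mem_map.mp this
      exact Finset.mem_singleton.mpr ((h.eq_iff a b).mp hb.symm).1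
    have := Finset.card_le_card hsub
    rw [hG.card_eq hc, Finset.card_singleton] at this
    omega
  have hf : ∀ e ∈ starOn (edgeSystem G) A u,
      matchEval (edgeSystem K) ((A.map f ∪ B.map g) \ e.map f) x =
        matchEval (edgeSystem G) (A \ e) x * matchEval (edgeSystem H) (B.erase w) x := by
    intro e he
    have hue := (mem_starOn.mp he).2.2
    rw [h.map_union_sdiff A B hue, h.matchEval_disjoint hr hG hH (by simp [hue]) (by simp)]
  have hg : ∀ e ∈ starOn (edgeSystem H) B w,
      matchEval (edgeSystem K) ((A.map f ∪ B.map g) \ e.map g) x =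
        matchEval (edgeSystem H) (B \ e) x * matchEval (edgeSystem G) (A.erase u) x := by
    intro e he
    have hwe := (mem_starOn.mp he).2.2
    rw [Finset.union_comm, h.symm.map_union_sdiff B A hwe,
      h.symm.matchEval_disjoint hr hH hG (by simp [hwe]) (by simp)]
  have h1 := matchEval_vertex (edgeSystem K)
    (Finset.mem_union_left (B.map g) (Finset.mem_map_of_mem f hA)) x
  rw [h.map_union_erase, h.matchEval_disjoint hr hG hH (Finset.notMem_erase _ _) (Finset.notMem_erase _ _), h.starOn_union hr hG hH A B hA hB,
    Finset.sum_union hdis, Finset.sum_map, Finset.sum_map] at h1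
  simp only [RelEmbedding.coe_toEmbedding, Finset.mapEmbedding_apply] at h1
  rw [Finset.sum_congr rfl hf, Finset.sum_congr rfl hg, ← Finset.sum_mul, ← Finset.sum_mul] at h1
  -- The recurrences at `u` in `G` and at `w` in `H` eliminate the two edge sums from the recurrence
  -- at the common vertex.
  have h2 := matchEval_vertex (edgeSystem G) hA x
  have h3 := matchEval_vertex (edgeSystem H) hB x
  rw [h1]
  linear_combination (-matchEval (edgeSystem H) (B.erase w) x) * h2 -
    matchEval (edgeSystem G) (A.erase u) x * h3

lemma ncard_vertexSet (h : IsGluing K G H f g u w) (hG : V(G).Finite) (hH : V(H).Finite) :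
    V(K).ncard + 1 = V(G).ncard + V(H).ncard := by
  have hu : u ∈ hG.toFinset := by simpa using h.left_mem
  have hw : w ∈ hH.toFinset := by simpa using h.right_mem
  have h1 := congrArg Finset.card (h.map_union_erase hG.toFinset hH.toFinset)
  rw [Finset.card_union_of_disjoint (h.disjoint_map (Or.inl (Finset.notMem_erase _ _))),
    Finset.card_map, Finset.card_map, Finset.card_erase_of_mem hu, Finset.card_erase_of_mem hw,
    Finset.card_erase_of_mem (Finset.mem_union_left _ (Finset.mem_map_of_mem f hu))] at h1
  rw [Set.ncard_eq_toFinset_card _ (h.finite hG hH), h.toFinset_eq (h.finite hG hH) hG hH,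
    Set.ncard_eq_toFinset_card _ hG, Set.ncard_eq_toFinset_card _ hH]
  have h2 : 0 < (hG.toFinset.map f ∪ hH.toFinset.map g).card :=
    Finset.card_pos.mpr ⟨_, Finset.mem_union_left _ (Finset.mem_map_of_mem f hu)⟩
  have h3 := Finset.card_pos.mpr ⟨u, hu⟩
  have h4 := Finset.card_pos.mpr ⟨w, hw⟩
  omega

end IsGluing

end Evaluation

section Grafting

open Classical

variable {α : Type*}

/-! ### Grafting two loose paths -/

variable {r : ℕ} {T : Hypergraph α} {v : α}

lemma zero_mem_loosePath (r m : ℕ) : 0 ∈ V(loosePath r m) := Nat.zero_le _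

lemma isGluing_graft_left (r : ℕ) (hv : v ∈ V(T)) (p : ℕ) :
    IsGluing (coalescence T v (loosePath r p) 0) T (loosePath r p)
      ⟨Sum.inl, Sum.inl_injective⟩ (glueRight v 0) v 0 :=
  isGluing_coalescence T v (loosePath r p) 0 hv (zero_mem_loosePath r p)

lemma isGluing_graft (r : ℕ) (hv : v ∈ V(T)) (p q : ℕ) :
    IsGluing (graft r T v p q) (coalescence T v (loosePath r p) 0) (loosePath r q)
      ⟨Sum.inl, Sum.inl_injective⟩ (glueRight (Sum.inl v) 0) (Sum.inl v) 0 :=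
  isGluing_coalescence _ _ (loosePath r q) 0 (Or.inl ⟨v, hv, rfl⟩) (zero_mem_loosePath r q)

lemma finite_graft (hv : v ∈ V(T)) (hfin : V(T).Finite) (p q : ℕ) :
    V(graft r T v p q).Finite :=
  (isGluing_graft r hv p q).finite
    ((isGluing_graft_left r hv p).finite hfin (finite_loosePath r p)) (finite_loosePath r q)

lemma isUniform_coalescence_loosePath (hr : 2 ≤ r) (hv : v ∈ V(T)) (hunif : T.IsUniform r)
    (p : ℕ) : (coalescence T v (loosePath r p) 0).IsUniform r :=
  (isGluing_graft_left r hv p).isUniform hunif (isUniform_loosePath (by omega) p)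

lemma isUniform_graft (hr : 2 ≤ r) (hv : v ∈ V(T)) (hunif : T.IsUniform r) (p q : ℕ) :
    (graft r T v p q).IsUniform r :=
  (isGluing_graft r hv p q).isUniform (isUniform_coalescence_loosePath hr hv hunif p)
    (isUniform_loosePath (by omega) q)

lemma separatesEdges_graft (hv : v ∈ V(T)) (hsep : SeparatesEdges E(T)) (p q : ℕ) :
    SeparatesEdges E(graft r T v p q) :=
  (isGluing_graft r hv p q).separatesEdges
    ((isGluing_graft_left r hv p).separatesEdges hsep (separatesEdges_loosePath r p))
    (separatesEdges_loosePath r q)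

lemma linksVertices_graft (hr : 2 ≤ r) (hv : v ∈ V(T)) (hlink : T.LinksVertices) (p q : ℕ) :
    (graft r T v p q).LinksVertices :=
  (isGluing_graft r hv p q).linksVertices
    ((isGluing_graft_left r hv p).linksVertices hlink (linksVertices_loosePath hr p))
    (linksVertices_loosePath hr q)

lemma edgeSet_graft_nonempty (hedge : E(T).Nonempty) (p q : ℕ) :
    E(graft r T v p q).Nonempty := by
  obtain ⟨e, he⟩ := hedge
  exact ⟨_, Or.inl ⟨_, Or.inl ⟨e, he, rfl⟩, rfl⟩⟩

variable [DecidableEq α]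

/-! ### Matching polynomials of loose paths -/

lemma mem_edgeSystem_loosePath {r m : ℕ} {e : Finset ℕ} :
    e ∈ edgeSystem (loosePath r m) ↔
      ∃ i < m, e = Finset.Icc (i * (r - 1)) ((i + 1) * (r - 1)) := by
  refine exists_congr fun i => and_congr_right fun _ => ?_
  rw [← Finset.coe_Icc, Finset.coe_inj]

/-- The matching polynomial of a loose path, evaluated at `x`. -/
def pathEval (r : ℕ) (x : ℝ) (m : ℕ) : ℝ :=
  matchEval (edgeSystem (loosePath r m)) (Finset.range (m * (r - 1) + 1)) x

/-- The matching polynomial of a loose path without its end vertex `0`, evaluated at `x`. -/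
def pathEvalErase (r : ℕ) (x : ℝ) (m : ℕ) : ℝ :=
  matchEval (edgeSystem (loosePath r m)) ((Finset.range (m * (r - 1) + 1)).erase 0) x

lemma toFinset_loosePath (r m : ℕ) :
    (finite_loosePath r m).toFinset = Finset.range (m * (r - 1) + 1) := by
  ext k
  simp [loosePath]

lemma map_shift_mem_loosePath {r : ℕ} (hr : 2 ≤ r) (m : ℕ) (e : Finset ℕ) :
    e.map (addRightEmbedding (r - 1)) ∈ edgeSystem (loosePath r (m + 1)) ↔
      e ∈ edgeSystem (loosePath r m) := by
  rw [mem_edgeSystem_loosePath, mem_edgeSystem_loosePath]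
  constructor
  · rintro ⟨i, hi, he⟩
    rcases i with _ | i
    · have h0 : 0 ∈ e.map (addRightEmbedding (r - 1)) := by rw [he]; simp
      obtain ⟨a, -, ha⟩ := Finset.mem_map.mp h0
      simp only [addRightEmbedding_apply] at ha
      omega
    · refine ⟨i, by omega, Finset.map_injective (addRightEmbedding (r - 1)) ?_⟩
      rw [he, Finset.map_add_right_Icc]
      congr 1 <;> ring
  · rintro ⟨i, hi, rfl⟩
    refine ⟨i + 1, by omega, ?_⟩
    rw [Finset.map_add_right_Icc]
    congr 1 <;> ring

lemma matchEval_shift_loosePath {r : ℕ} (hr : 2 ≤ r) (m : ℕ) (W : Finset ℕ) (x : ℝ) :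
    matchEval (edgeSystem (loosePath r (m + 1))) (W.map (addRightEmbedding (r - 1))) x =
      matchEval (edgeSystem (loosePath r m)) W x :=
  matchEval_map _ ((isUniform_loosePath (by omega) m).empty_notMem (by omega)) W
    (fun e _ => map_shift_mem_loosePath hr m e) x

lemma pathEval_zero (r : ℕ) (x : ℝ) : pathEval r x 0 = x := by
  rw [pathEval, matchEval_of_no_edges]
  · simp
  · rintro e ⟨i, hi, -⟩
    exact absurd hi (Nat.not_lt_zero _)

lemma pathEvalErase_zero (r : ℕ) (x : ℝ) : pathEvalErase r x 0 = 1 := by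
  rw [pathEvalErase, matchEval_of_no_edges]
  · simp
  · rintro e ⟨i, hi, -⟩
    exact absurd hi (Nat.not_lt_zero _)

/-- Only the first block contains 0, and deleting it leaves the path with one edge fewer, shifted by
`r - 1` and without its end. -/
lemma pathEval_succ {r : ℕ} (hr : 2 ≤ r) (x : ℝ) (m : ℕ) :
    pathEval r x (m + 1) = x * pathEvalErase r x (m + 1) - pathEvalErase r x m := by
  have hstar : starOn (edgeSystem (loosePath r (m + 1)))
      (Finset.range ((m + 1) * (r - 1) + 1)) 0 = {Finset.Icc 0 (r - 1)} := by
    ext e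
    rw [mem_starOn, mem_edgeSystem_loosePath, Finset.mem_singleton]
    constructor
    · rintro ⟨-, ⟨i, hi, rfl⟩, h0⟩
      have : i = 0 := by
        have := (Finset.mem_Icc.mp h0).1
        have := Nat.eq_zero_of_le_zero this
        rcases Nat.mul_eq_zero.mp this with h | h <;> omega
      simp [this]
    · rintro rfl
      refine ⟨fun k hk => ?_, ⟨0, by omega, by simp⟩, by simp⟩
      have := (Finset.mem_Icc.mp hk).2
      rw [Finset.mem_range, add_mul]
      omega
  have hsdiff : Finset.range ((m + 1) * (r - 1) + 1) \ Finset.Icc 0 (r - 1) =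
      ((Finset.range (m * (r - 1) + 1)).erase 0).map (addRightEmbedding (r - 1)) := by
    ext k
    simp only [Finset.mem_sdiff, Finset.mem_range, Finset.mem_Icc, Finset.mem_map, Finset.mem_erase,
      addRightEmbedding_apply, add_mul]
    constructor
    · rintro ⟨h1, h2⟩
      exact ⟨k - (r - 1), by omega, by omega⟩
    · rintro ⟨a, h1, rfl⟩
      omega
  rw [pathEval, matchEval_vertex _ (v := 0) (by simp), hstar, Finset.sum_singleton, hsdiff,
    matchEval_shift_loosePath hr, pathEvalErase, pathEvalErase]

/-- Without 0 the first block is no longer an edge: its `r - 2` inner vertices become isolated, and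
a shifted path with `m` edges remains. -/
lemma pathEvalErase_succ {r : ℕ} (hr : 2 ≤ r) (x : ℝ) (m : ℕ) :
    pathEvalErase r x (m + 1) = x ^ (r - 2) * pathEval r x m := by
  have hsplit : (Finset.range ((m + 1) * (r - 1) + 1)).erase 0 =
      Finset.Icc 1 (r - 2) ∪
        (Finset.range (m * (r - 1) + 1)).map (addRightEmbedding (r - 1)) := by
    ext k
    simp only [Finset.mem_union, Finset.mem_range, Finset.mem_Icc, Finset.mem_map,
      Finset.mem_erase, addRightEmbedding_apply, add_mul]
    constructor
    · rintro ⟨h1, h2⟩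
      by_cases hk : k ≤ r - 2
      · omega
      · exact Or.inr ⟨k - (r - 1), by omega, by omega⟩
    · rintro (h | ⟨a, h1, rfl⟩) <;> omega
  have hblock : ∀ i, r - 1 ≤ (i + 1) * (r - 1) := fun i =>
    Nat.le_mul_of_pos_left _ (Nat.succ_pos i)
  rw [pathEvalErase, hsplit, matchEval_union
    (E := edgeSystem (loosePath r (m + 1))) ((isUniform_loosePath (by omega) _).empty_notMem (by omega)), matchEval_shift_loosePath hr,
    matchEval_of_no_edges, Nat.card_Icc, pathEval]
  · congr 2
  · intro e he hsub
    obtain ⟨i, -, rfl⟩ := mem_edgeSystem_loosePath.mp he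
    have := hsub (Finset.right_mem_Icc.mpr (Nat.mul_le_mul_right _ (Nat.le_succ i)))
    have := (Finset.mem_Icc.mp this).2
    have := hblock i
    omega
  · rw [Finset.disjoint_left]
    intro k hk hk'
    obtain ⟨a, -, rfl⟩ := Finset.mem_map.mp hk'
    rw [Finset.mem_Icc, addRightEmbedding_apply] at hk
    omega
  · intro e he hsub
    right
    obtain ⟨i, hi, rfl⟩ := mem_edgeSystem_loosePath.mp he
    rcases i with _ | i
    · exfalso
      rw [← hsplit] at hsub
      have := hsub (show 0 ∈ _ by simp)
      simp at this
    · intro k hk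
      refine (Finset.mem_union.mp (hsub hk)).resolve_left fun h => ?_
      have h1 := (Finset.mem_Icc.mp h).2
      have h2 := (Finset.mem_Icc.mp hk).1
      have := hblock i
      omega

/-- A shorter path is an induced initial segment of a longer one. This places Q_d inside the graft,
where its positivity is known. -/
lemma matchEval_subpath (r : ℕ) (hr : 2 ≤ r) {d m : ℕ} (hdm : d ≤ m) (x : ℝ) :
    matchEval (edgeSystem (loosePath r m)) ((Finset.range (d * (r - 1) + 1)).erase 0) x =
      pathEvalErase r x d := by
  refine matchEval_congr (fun e he => ?_) x
  rw [mem_edgeSystem_loosePath, mem_edgeSystem_loosePath]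
  constructor
  · rintro ⟨i, hi, rfl⟩
    refine ⟨i, ?_, rfl⟩
    have h1 := he (Finset.right_mem_Icc.mpr (Nat.mul_le_mul_right _ (Nat.le_succ i)))
    have h2 := Finset.mem_range.mp (Finset.mem_of_mem_erase h1)
    exact Nat.le_of_mul_le_mul_right (Nat.lt_succ_iff.mp h2) (by omega)
  · rintro ⟨i, hi, rfl⟩
    exact ⟨i, by omega, rfl⟩

/-- The determinant-type identity behind the comparison of two pairs of paths. -/
lemma path_pair_identity {P Q : ℕ → ℝ} {x s : ℝ} (hP0 : P 0 = x) (hQ0 : Q 0 = 1)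
    (hP : ∀ m, P (m + 1) = x * Q (m + 1) - Q m) (hQ : ∀ m, Q (m + 1) = s * P m) (A B : ℝ)
    (k d : ℕ) :
    ((A * Q (k + d + 2) + B * P (k + d + 2) - x * B * Q (k + d + 2)) * Q k +
        B * Q (k + d + 2) * P k - x * (B * Q (k + d + 2)) * Q k) -
      ((A * Q (k + d + 1) + B * P (k + d + 1) - x * B * Q (k + d + 1)) * Q (k + 1) +
        B * Q (k + d + 1) * P (k + 1) - x * (B * Q (k + d + 1)) * Q (k + 1)) =
      s ^ (k + 1) * Q d * (x * B - A) := by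
  have hrec : ∀ m, Q (m + 2) = s * (x * Q (m + 1) - Q m) := fun m => by rw [hQ, hP]
  have hQ1 : Q 1 = s * x := by rw [hQ, hP0]
  -- A 2 × 2 determinant of solutions of a second-order recurrence: each step multiplies it by `s`.
  have hD : ∀ k, Q (k + d + 1) * Q (k + 1) - Q (k + d + 2) * Q k = s ^ (k + 1) * Q d := by
    intro k
    induction k with
    | zero => simp only [Nat.zero_add, hrec d, hQ0, hQ1]; ring
    | succ k ih =>
      rw [show k + 1 + d + 1 = k + d + 2 by ring, show k + 1 + d + 2 = k + d + 1 + 2 by ring,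
        hrec (k + d + 1), hrec k, pow_succ s (k + 1), show k + d + 1 + 1 = k + d + 2 by ring]
      linear_combination s * ih
  have hN : ∀ m, P (m + 1) - x * Q (m + 1) = -Q m := fun m => by rw [hP]; ring
  -- This handles the coefficient of `B`. For `k = j + 1` the bracket is `-Q j`, and expanding both
  -- longer terms by `hrec` leaves `x * s` times `hD j`; `k = 0` is separate because it has no
  -- predecessor.
  have hM : Q (k + d) * Q (k + 1) + Q (k + d + 2) * (P k - x * Q k) =
      x * s ^ (k + 1) * Q d := by
    rcases k with _ | j
    · simp only [Nat.zero_add, hP0, hQ0, hQ1]; ring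
    · rw [hN, show j + 1 + d + 2 = j + d + 1 + 2 by ring, hrec (j + d + 1), hrec j,
        show j + d + 1 + 1 = j + d + 2 by ring, show j + 1 + d = j + d + 1 by ring,
        pow_succ s (j + 1)]
      linear_combination x * s * hD j
  have h1 := hN (k + d + 1)
  have h2 := hN (k + d)
  have h3 := hN k
  rw [show k + d + 1 + 1 = k + d + 2 by ring] at h1
  linear_combination (-A) * hD k + B * hM + B * Q k * h1 - B * Q (k + 1) * h2 -
    B * Q (k + d + 1) * h3

/-! ### Comparison of grafted paths -/

lemma ncard_loosePath (r m : ℕ) : V(loosePath r m).ncard = m * (r - 1) + 1 := by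
  rw [Set.ncard_eq_toFinset_card _ (finite_loosePath r m), toFinset_loosePath, Finset.card_range]

lemma ncard_graft (hv : v ∈ V(T)) (hfin : V(T).Finite) (p q : ℕ) :
    V(graft r T v p q).ncard = V(T).ncard + (p + q) * (r - 1) := by
  have h1 := (isGluing_graft_left r hv p).ncard_vertexSet hfin (finite_loosePath r p)
  have h2 := (isGluing_graft r hv p q).ncard_vertexSet
    ((isGluing_graft_left r hv p).finite hfin (finite_loosePath r p)) (finite_loosePath r q)
  rw [ncard_loosePath] at h1 h2
  rw [add_mul]
  omega

/-- Apply the gluing formula once for each path. In the intermediate hypergraph, deleting `v`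
separates T − v from the first path without its end. -/
lemma matchEval_graft (hr : 2 ≤ r) (hv : v ∈ V(T)) (hfin : V(T).Finite) (hunif : T.IsUniform r)
    (p q : ℕ) (x : ℝ) :
    matchEval (edgeSystem (graft r T v p q)) (finite_graft (r := r) hv hfin p q).toFinset x =
      (matchEval (edgeSystem T) hfin.toFinset x * pathEvalErase r x p +
          matchEval (edgeSystem T) (hfin.toFinset.erase v) x * pathEval r x p -
          x * matchEval (edgeSystem T) (hfin.toFinset.erase v) x * pathEvalErase r x p) *
          pathEvalErase r x q +
        matchEval (edgeSystem T) (hfin.toFinset.erase v) x * pathEvalErase r x p * pathEval r x q -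
        x * (matchEval (edgeSystem T) (hfin.toFinset.erase v) x * pathEvalErase r x p) *
          pathEvalErase r x q := by
  have g1 := isGluing_graft_left r hv p
  have g2 := isGluing_graft r hv p q
  have hfin1 := g1.finite hfin (finite_loosePath r p)
  have hu1 := isUniform_coalescence_loosePath hr hv hunif p
  have huP : ∀ m, (loosePath r m).IsUniform r := isUniform_loosePath (by omega)
  have hvT : v ∈ hfin.toFinset := by simpa using hv
  rw [g2.toFinset_eq _ hfin1 (finite_loosePath r q), toFinset_loosePath,
    g2.matchEval_gluing hr hu1 (huP q) (by simpa using g2.left_mem) (by simp),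
    g1.toFinset_eq hfin1 hfin (finite_loosePath r p), toFinset_loosePath,
    g1.matchEval_gluing hr hunif (huP p) hvT (by simp)]
  have herase := g1.map_union_erase hfin.toFinset (Finset.range (p * (r - 1) + 1))
  rw [Function.Embedding.coeFn_mk] at herase
  rw [herase, g1.matchEval_disjoint hr hunif (huP p) (Finset.notMem_erase _ _)
    (Finset.notMem_erase _ _)]
  rfl

/-- If no edge met `v`, the set `{v}` would be uncrossed, against connectedness. This makes xB − A a
nonempty sum and the comparison strict. -/
lemma exists_mem_starOn (hr : 2 ≤ r) (hv : v ∈ V(T)) (hfin : V(T).Finite) (hunif : T.IsUniform r)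
    (hlink : T.LinksVertices) (hedge : E(T).Nonempty) :
    (starOn (edgeSystem T) hfin.toFinset v).Nonempty := by
  by_contra hcon
  have hno : ∀ e ∈ E(T), v ∉ e := by
    intro e he hve
    refine hcon ⟨(hfin.subset (subset_vertexSet_of_mem_edgeSet he)).toFinset, ?_⟩
    rw [mem_starOn]
    exact ⟨Set.Finite.toFinset_mono (subset_vertexSet_of_mem_edgeSet he),
      by simpa [mem_edgeSystem] using he, by simpa using hve⟩
  obtain ⟨e, he⟩ := hedge
  have hne : e.Nonempty := by
    rw [← Set.encard_pos, hunif e he]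
    exact_mod_cast (by omega : 0 < r)
  obtain ⟨b, hb⟩ := hne
  have := hlink {v} (fun f hf a ha hav => absurd (hav ▸ ha) (hno f hf)) v hv b
    (mem_vertexSet_of_mem_edgeSet he hb) rfl
  exact hno e he (this ▸ hb)

/-- Moving an edge from the shorter pendent path to the longer one increases the matching polynomial
from the spectral radius on. -/
lemma matchEval_graft_lt (hr : 2 ≤ r) (hv : v ∈ V(T)) (hfin : V(T).Finite)
    (hunif : T.IsUniform r) (hsep : SeparatesEdges E(T)) (hlink : T.LinksVertices)
    (hedge : E(T).Nonempty) (k d : ℕ) {x : ℝ}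
    (hx : spectralRadius r (graft r T v (k + d + 2) k) ≤ x) :
    matchEval (edgeSystem (graft r T v (k + d + 1) (k + 1)))
        (finite_graft (r := r) hv hfin (k + d + 1) (k + 1)).toFinset x <
      matchEval (edgeSystem (graft r T v (k + d + 2) k))
        (finite_graft (r := r) hv hfin (k + d + 2) k).toFinset x := by
  have g1 := isGluing_graft_left r hv (k + d + 2)
  have g2 := isGluing_graft r hv (k + d + 2) k
  have hfin1 := g1.finite hfin (finite_loosePath r _)
  have hu1 := isUniform_coalescence_loosePath hr hv hunif (k + d + 2)
  have huP : ∀ m, (loosePath r m).IsUniform r := isUniform_loosePath (by omega)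
  obtain ⟨hone, -, -, hpos⟩ := spectralRadius_eq_largest_root hr _
    (finite_graft (r := r) hv hfin (k + d + 2) k) (isUniform_graft hr hv hunif _ _)
    (separatesEdges_graft hv hsep _ _) (linksVertices_graft hr hv hlink _ _)
    (edgeSet_graft_nonempty hedge _ _)
  have hV := g2.toFinset_eq (finite_graft (r := r) hv hfin (k + d + 2) k) hfin1 (finite_loosePath r k)
  have hV1 := g1.toFinset_eq hfin1 hfin (finite_loosePath r (k + d + 2))
  -- Proper subsystems of `T` with the longer path are proper in the graft too. Both T − e and Q_d
  -- are reached through this.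
  have hss : ∀ W ⊂ hfin1.toFinset,
      0 < matchEval (edgeSystem (coalescence T v (loosePath r (k + d + 2)) 0)) W x := by
    intro W hW
    rw [← g2.matchEval_map_left hr hu1 (huP k)]
    refine hpos _ ?_ x hx
    rw [hV]
    obtain ⟨z, hz, hzW⟩ := Finset.exists_of_ssubset hW
    refine (Finset.ssubset_iff_of_subset
      ((Finset.map_subset_map.mpr hW.1).trans Finset.subset_union_left)).mpr
      ⟨_, Finset.mem_union_left _ (Finset.mem_map_of_mem _ hz), ?_⟩
    rwa [Finset.mem_map' ]
  have hT : ∀ e ∈ starOn (edgeSystem T) hfin.toFinset v,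
      0 < matchEval (edgeSystem T) (hfin.toFinset \ e) x := by
    intro e he
    rw [← g1.matchEval_map_left hr hunif (huP _)]
    refine hss _ ?_
    rw [hV1]
    refine (Finset.ssubset_iff_of_subset ((Finset.map_subset_map.mpr Finset.sdiff_subset).trans
      Finset.subset_union_left)).mpr
      ⟨_, Finset.mem_union_left _ (Finset.mem_map_of_mem _ (a := v) (by simpa using hv)), ?_⟩
    rw [Finset.mem_map', Finset.mem_sdiff]
    exact fun h => h.2 (mem_starOn.mp he).2.2
  have hQ : 0 < pathEvalErase r x d := by
    rw [← matchEval_subpath r hr (show d ≤ k + d + 2 by omega),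
      ← g1.symm.matchEval_map_left hr (huP _) hunif]
    refine hss _ ?_
    rw [hV1, toFinset_loosePath]
    refine (Finset.ssubset_iff_of_subset ((Finset.map_subset_map.mpr ?_).trans
      Finset.subset_union_right)).mpr
      ⟨_, Finset.mem_union_right _ (Finset.mem_map_of_mem _ (a := 0) (by simp)), ?_⟩
    · refine (Finset.erase_subset _ _).trans (Finset.range_subset_range.mpr ?_)
      have := Nat.mul_le_mul_right (r - 1) (show d ≤ k + d + 2 by omega)
      omega
    · rw [Finset.mem_map']
      exact Finset.notMem_erase _ _
  have hid := path_pair_identity (pathEval_zero r x) (pathEvalErase_zero r x)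
    (pathEval_succ hr x) (pathEvalErase_succ hr x)
    (matchEval (edgeSystem T) hfin.toFinset x)
    (matchEval (edgeSystem T) (hfin.toFinset.erase v) x) k d
  rw [← matchEval_graft hr hv hfin hunif, ← matchEval_graft hr hv hfin hunif] at hid
  have hx0 : 0 < x := by linarith
  -- By the recurrence at `v` this difference is the sum over the edges at `v`, each term positive
  -- by `hT`.
  have hsum : 0 < x * matchEval (edgeSystem T) (hfin.toFinset.erase v) x -
      matchEval (edgeSystem T) hfin.toFinset x := by
    rw [matchEval_vertex (edgeSystem T) (V := hfin.toFinset) (v := v) (by simpa using hv),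
      sub_sub_cancel]
    exact Finset.sum_pos hT (exists_mem_starOn hr hv hfin hunif hlink hedge)
  have := mul_pos (mul_pos (pow_pos (pow_pos hx0 (r - 2)) (k + 1)) hQ) hsum
  linarith

end Grafting

end Hypergraph

end

/-! ### The theorem -/

theorem mainTheorem4 {α : Type*} (r : ℕ) (hr : 2 ≤ r)
    (T : Hypergraph α) (hfin : T.vertexSet.Finite) (hunif : T.IsUniform r)
    (htree : T.IsSupertree) (hedge : T.edgeSet.Nonempty)
    (v : α) (hv : v ∈ T.vertexSet)
    (p q : ℕ) (hpq : q ≤ p) (hq : 1 ≤ q) :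
    Hypergraph.MatchLT r (Hypergraph.graft r T v (p + 1) (q - 1)) (Hypergraph.graft r T v p q) ∧
      Hypergraph.spectralRadius r (Hypergraph.graft r T v (p + 1) (q - 1)) <
        Hypergraph.spectralRadius r (Hypergraph.graft r T v p q) := by
  classical
  -- `d` is the difference `p - q`, the length of the path whose Q_d appears in the identity.
  obtain ⟨k, rfl⟩ : ∃ k, q = k + 1 := ⟨q - 1, by omega⟩
  obtain ⟨d, rfl⟩ : ∃ d, p = k + d + 1 := ⟨p - (k + 1), by omega⟩
  rw [Nat.add_sub_cancel, show k + d + 1 + 1 = k + d + 2 from rfl]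
  have hsep := htree.2.separatesEdges
  have hlink := htree.1.linksVertices
  have hpoly : ∀ a b x, (Hypergraph.matchingPoly r (Hypergraph.graft r T v a b)).eval x =
      Hypergraph.matchEval (Hypergraph.edgeSystem (Hypergraph.graft r T v a b))
        (Hypergraph.finite_graft hv hfin a b).toFinset x := fun a b x =>
    Hypergraph.eval_matchingPoly (by omega) _ _ (Hypergraph.isUniform_graft hr hv hunif a b) x
  have hlt : ∀ x, Hypergraph.spectralRadius r (Hypergraph.graft r T v (k + d + 2) k) ≤ x → _ :=
    fun x hx => Hypergraph.matchEval_graft_lt hr hv hfin hunif hsep hlink hedge k d hx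
  have hroot : ∀ a b, _ := fun a b => Hypergraph.spectralRadius_eq_largest_root hr
    (Hypergraph.graft r T v a b) (Hypergraph.finite_graft hv hfin a b)
    (Hypergraph.isUniform_graft hr hv hunif a b) (Hypergraph.separatesEdges_graft hv hsep a b)
    (Hypergraph.linksVertices_graft hr hv hlink a b)
    (Hypergraph.edgeSet_graft_nonempty hedge a b)
  refine ⟨⟨⟨Hypergraph.finite_graft hv hfin _ _, Hypergraph.finite_graft hv hfin _ _,
    Hypergraph.isUniform_graft hr hv hunif _ _, Hypergraph.isUniform_graft hr hv hunif _ _,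
    (Hypergraph.separatesEdges_graft hv hsep _ _).isSuperforest,
    (Hypergraph.separatesEdges_graft hv hsep _ _).isSuperforest, ?_, ?_⟩, ?_⟩, ?_⟩
  · rw [Hypergraph.ncard_graft hv hfin, Hypergraph.ncard_graft hv hfin]
    congr 2
    ring
  · intro x hx
    rw [hpoly, hpoly]
    exact (hlt x hx).le
  · rw [Polynomial.eval_sub, hpoly, hpoly]
    exact (sub_pos.mpr (hlt _ le_rfl)).ne'
  -- At the radius of the graft with path lengths `k + d + 2` and `k` the other polynomial is
  -- negative, whereas it is zero at its own radius and positive beyond.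
  · by_contra! hcon
    have h1 := hlt _ le_rfl
    rw [(hroot (k + d + 2) k).2.1] at h1
    rcases eq_or_lt_of_le hcon with h2 | h2
    · rw [← h2, (hroot (k + d + 1) (k + 1)).2.1] at h1
      exact lt_irrefl _ h1
    · exact absurd ((hroot (k + d + 1) (k + 1)).2.2.1 _ h2) (not_lt.mpr h1.le)
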